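/- Let $R$ be a commutative ring containing a regular local ring $(R',\mathfrak m')$ as a subring such that $R$ is finitely generated as an $R'$-module, and assume that $R$ is equidimensional, i.e. $\dim(R/\mathfrak r)=\dim R$ for every minimal prime $\mathfrak r$ of $R$. Let $\mathfrak p$ be a prime ideal of $R$ and put $\mathfrak p'=\mathfrak p\cap R'$. For a Noetherian local ring $(A,\mathfrak n)$ of dimension $d$ let $e(A)=d!\,e_d$ denote its Hilbert-Samuel multiplicity, where $e_d$ is the leading coefficient of the polynomial, of degree $d$, which agrees with $t\mapsto\operatorname{length}(A/\mathfrak n^{\,t+1})$ for all integers $t\gg 0$. Assume that $e(R_{\mathfrak p})=\operatorname{rank}_{R'}(R)$, where $\operatorname{rank}_{R'}(R)=\dim_{K}(R\otimes_{R'}K)$ and $K$ is the fraction field of $R'$. Then $\mathfrak p$ is the unique prime ideal of $R$ with $\mathfrak p\cap R'=\mathfrak p'$, and the canonical homomorphism of residue fields $\kappa(\mathfrak p')\to\kappa(\mathfrak p)$ is an isomorphism, where $\kappa(\mathfrak a)$ is the fraction field of the quotient of the ring by the prime $\mathfrak a$. -/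

import Mathlib

/-- A commutative ring `R` is equidimensional if `dim (R/r) = dim R` for every minimal
prime `r` of `R`. -/
def IsEquidimensionalRing (R : Type*) [CommRing R] : Prop :=
  ∀ r ∈ minimalPrimes R, ringKrullDim (R ⧸ r) = ringKrullDim R

/-- `P` is the Hilbert polynomial of the ideal `a` on the module `M`: for `n ≫ 0` the length of
`M / a ^ (n + 1) M` is finite and equal to `P n`. Such a `P` is unique when it exists. -/
def IsHilbertPolynomial {A : Type*} [CommRing A] (a : Ideal A) (M : Type*) [AddCommGroup M]
    [Module A M] (P : Polynomial ℚ) : Prop :=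
  ∀ᶠ n : ℕ in Filter.atTop, ∃ l : ℕ,
    Module.length A (M ⧸ (a ^ (n + 1) • (⊤ : Submodule A M))) = (l : ℕ∞) ∧
      (l : ℚ) = P.eval (n : ℚ)

/-- The Krull dimension of a module, as a natural number
(`0` for the zero module and for modules of infinite dimension). -/
noncomputable def moduleDim (A : Type*) [CommRing A] (M : Type*) [AddCommGroup M]
    [Module A M] : ℕ :=
  ((Module.supportDim A M).unbotD 0).toNat

open Classical in
/-- The Hilbert-Samuel multiplicity `e(a, M)`: if `d = dim M` and `e_d` is the coefficient of
`n ^ d` in the Hilbert polynomial of `a` on `M`, then `e(a, M) = d! * e_d`. (For a nonzero finite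
module over a Noetherian local ring and `a` primary to the maximal ideal, the Hilbert polynomial
exists and has degree `d`, so that `e_d` is its leading coefficient. The value is `0` when there
is no Hilbert polynomial.) -/
noncomputable def idealMultiplicity {A : Type*} [CommRing A] (a : Ideal A) (M : Type*)
    [AddCommGroup M] [Module A M] : ℚ :=
  if h : ∃ P : Polynomial ℚ, IsHilbertPolynomial a M P then
    ((moduleDim A M).factorial : ℚ) * h.choose.coeff (moduleDim A M)
  else 0

/-- The Hilbert-Samuel multiplicity `e(A) = e(n, A)` of a local ring `(A, n)`. -/
noncomputable def localMultiplicity (A : Type*) [CommRing A] [IsLocalRing A] : ℚ :=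
  idealMultiplicity (IsLocalRing.maximalIdeal A) A

/-! Write p' = p ∩ R', B = R'_{p'}, h = dim B, r = rank R, and let m be the maximal ideal of B. The
finite B-module M = B ⊗ R has rank r, so length(M/m^n M) is at most r n^h/h! + O(n^(h-1)). On the
other hand M/m^n M maps onto R_q/(qR_q)^n for every prime q over p', and onto the product for two
such primes. Each local ring R_q has dimension at least h, so the length of R_q/(qR_q)^n grows at
least like a positive multiple of n^h.

Since e(R_p) = r, the factor R_p already uses up the whole leading term. A second prime q over p',
or a residue extension of degree at least 2 (which at least doubles the B-length of R_p/(pR_p)^n),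
would add a further term of order n^h: this is the contradiction in
`false_of_hilbertPolynomial_add_le`.

Two facts on regular rings are needed. B is again regular
(`IsRegularLocalRing.localization_atPrime`, by Serre's homological criterion), so m has h generators
and the length of B/m^(n+1) is at most C(n+h, h). R' is a normal domain
(`IsRegularLocalRing.isIntegrallyClosed`), so going down holds and, with equidimensionality, dim R_q
≥ h (`IsEquidimensionalRing.height_under_le_height`). -/

/-! ### Embedding dimension and quotients by one element -/

section Generators

open IsLocalRing

variable {A : Type*} [CommRing A] [IsLocalRing A]

theorem map_mk_maximalIdeal (I : Ideal A) [IsLocalRing (A ⧸ I)] :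
    (maximalIdeal A).map (Ideal.Quotient.mk I) = maximalIdeal (A ⧸ I) := by
  refine le_antisymm ?_ ?_
  · exact ((IsLocalRing.local_hom_TFAE (Ideal.Quotient.mk I)).out 0 2 rfl rfl).1
      (IsLocalHom.of_surjective _ Ideal.Quotient.mk_surjective)
  · intro a ha
    obtain ⟨a, rfl⟩ := Ideal.Quotient.mk_surjective a
    refine Ideal.mem_map_of_mem _ ?_
    intro h
    exact ha (h.map _)

theorem isLocalRing_quotient {I : Ideal A} (hI : I ≤ maximalIdeal A) : IsLocalRing (A ⧸ I) :=
  have : Nontrivial (A ⧸ I) :=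
    Ideal.Quotient.nontrivial_iff.2 fun h ↦ (maximalIdeal.isMaximal A).ne_top (top_le_iff.1 (h ▸ hI))
  .of_surjective' (Ideal.Quotient.mk I) Ideal.Quotient.mk_surjective

variable [IsNoetherianRing A]

/-- The class of x in the cotangent space is nonzero, hence part of a basis; by Nakayama, lifts of
the other basis vectors together with x generate. -/
theorem exists_finset_span_insert_eq_maximalIdeal {x : A} (hx : x ∈ maximalIdeal A)
    (hx2 : x ∉ maximalIdeal A ^ 2) :
    ∃ s : Finset A, s.card + 1 ≤ (maximalIdeal A).spanFinrank ∧
      Ideal.span (insert x (s : Set A)) = maximalIdeal A := by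
  classical
  set v : CotangentSpace A := (maximalIdeal A).toCotangent ⟨x, hx⟩ with hv
  have hv0 : v ≠ 0 := fun h ↦ hx2 (((maximalIdeal A).toCotangent_eq_zero _).1 h)
  have li : LinearIndepOn (ResidueField A) id ({v} : Set (CotangentSpace A)) :=
    (linearIndepOn_singleton_iff (ResidueField A)).2 hv0
  let t := li.extend (Set.subset_univ _)
  let b : Module.Basis t (ResidueField A) (CotangentSpace A) := Module.Basis.extend li
  have hbt : Set.range b = t := Module.Basis.range_extend li
  have hvt : v ∈ t := li.subset_extend _ rfl
  have : Finite t := Module.Finite.finite_basis b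
  have htf : t.Finite := Set.toFinite t
  have hcard : t.ncard = (maximalIdeal A).spanFinrank := by
    rw [spanFinrank_maximalIdeal_eq_finrank_cotangentSpace, Module.finrank_eq_nat_card_basis b]
    rfl
  let g := Function.surjInv (maximalIdeal A).toCotangent_surjective
  have hg : ∀ w, (maximalIdeal A).toCotangent (g w) = w :=
    Function.surjInv_eq (maximalIdeal A).toCotangent_surjective
  let s : Finset A := (htf.toFinset.erase v).image fun w ↦ (g w : A)
  refine ⟨s, ?_, ?_⟩
  · have h1 : s.card ≤ (htf.toFinset.erase v).card := Finset.card_image_le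
    have h2 : (htf.toFinset.erase v).card + 1 = htf.toFinset.card :=
      Finset.card_erase_add_one (by simpa using hvt)
    rw [← hcard, Set.ncard_eq_toFinset_card t htf]
    omega
  · let T : Set (maximalIdeal A) := insert ⟨x, hx⟩ (g '' (t \ {v}))
    have hT : Submodule.span A T = ⊤ := by
      rw [← CotangentSpace.span_image_eq_top_iff, eq_top_iff, ← b.span_eq, hbt]
      refine Submodule.span_mono fun w hw ↦ ?_
      by_cases hwv : w = v
      · exact ⟨⟨x, hx⟩, Set.mem_insert _ _, hwv.symm⟩
      · exact ⟨g w, Set.mem_insert_of_mem _ ⟨w, ⟨hw, hwv⟩, rfl⟩, hg w⟩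
    have := congrArg (Submodule.map (maximalIdeal A).subtype) hT
    rw [Submodule.map_span, Submodule.map_top, Submodule.range_subtype] at this
    rw [← this]
    change Submodule.span A _ = _
    congr 1
    simp only [T, s, Set.image_insert_eq, Submodule.subtype_apply, Set.image_image]
    congr 1
    ext a
    simp [and_comm]

theorem spanFinrank_maximalIdeal_quotient_add_one_le {x : A} (hx : x ∈ maximalIdeal A)
    (hx2 : x ∉ maximalIdeal A ^ 2) [IsLocalRing (A ⧸ Ideal.span {x})] :
    (maximalIdeal (A ⧸ Ideal.span {x})).spanFinrank + 1 ≤ (maximalIdeal A).spanFinrank := by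
  classical
  obtain ⟨s, hs, hsp⟩ := exists_finset_span_insert_eq_maximalIdeal hx hx2
  have hI : Ideal.span {x} ≤ maximalIdeal A := by simpa [Ideal.span_le] using hx
  have h : maximalIdeal (A ⧸ Ideal.span {x}) =
      Ideal.span (Ideal.Quotient.mk (Ideal.span {x}) '' s) := by
    rw [← map_mk_maximalIdeal, ← hsp, Ideal.map_span, Set.image_insert_eq,
      Ideal.Quotient.eq_zero_iff_mem.2 (Ideal.mem_span_singleton_self x), Ideal.span_insert_zero]
  rw [h]
  have h1 : (Ideal.span (Ideal.Quotient.mk (Ideal.span {x}) '' s)).spanFinrank ≤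
      (Ideal.Quotient.mk (Ideal.span {x}) '' (s : Set A)).ncard :=
    Submodule.spanFinrank_span_le_ncard_of_finite (s.finite_toSet.image _)
  have h2 : (Ideal.Quotient.mk (Ideal.span {x}) '' (s : Set A)).ncard ≤ s.card := by
    rw [← Set.ncard_coe_finset s]
    exact Set.ncard_image_le s.finite_toSet
  omega

theorem spanFinrank_maximalIdeal_le_quotient_add_one {x : A} (hx : x ∈ maximalIdeal A)
    [IsLocalRing (A ⧸ Ideal.span {x})] :
    (maximalIdeal A).spanFinrank ≤ (maximalIdeal (A ⧸ Ideal.span {x})).spanFinrank + 1 := by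
  classical
  have hI : Ideal.span {x} ≤ maximalIdeal A := by simpa [Ideal.span_le] using hx
  set I := Ideal.span {x}
  have hfg : (maximalIdeal (A ⧸ I)).FG := Ideal.fg_of_isNoetherianRing _
  let G := (maximalIdeal (A ⧸ I)).generators
  have hGf : G.Finite := Submodule.FG.finite_generators hfg
  let g : A ⧸ I → A := Function.surjInv Ideal.Quotient.mk_surjective
  have hg : ∀ w, Ideal.Quotient.mk I (g w) = w :=
    Function.surjInv_eq Ideal.Quotient.mk_surjective
  have hm : maximalIdeal A = Ideal.span (insert x (g '' G)) := by
    rw [Ideal.span_insert]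
    have h1 : (maximalIdeal (A ⧸ I)).comap (Ideal.Quotient.mk I) = maximalIdeal A := by
      rw [← map_mk_maximalIdeal, Ideal.comap_map_of_surjective _ Ideal.Quotient.mk_surjective,
        ← RingHom.ker_eq_comap_bot, Ideal.mk_ker, sup_eq_left.2 hI]
    have h2 : (Ideal.span (g '' G)).map (Ideal.Quotient.mk I) = maximalIdeal (A ⧸ I) := by
      rw [Ideal.map_span, Set.image_image]
      simp only [hg, Set.image_id']
      exact (maximalIdeal (A ⧸ I)).span_generators
    rw [← h1, ← h2, Ideal.comap_map_of_surjective _ Ideal.Quotient.mk_surjective,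
        ← RingHom.ker_eq_comap_bot, Ideal.mk_ker, sup_comm]
  rw [hm]
  refine (Submodule.spanFinrank_span_le_ncard_of_finite ((hGf.image g).insert x)).trans ?_
  refine (Set.ncard_insert_le _ _).trans ?_
  rw [← Submodule.FG.generators_ncard hfg]
  exact Nat.add_le_add_right (Set.ncard_image_le hGf) 1

theorem maximalIdeal_not_le_sq (h : maximalIdeal A ≠ ⊥) :
    ¬ maximalIdeal A ≤ maximalIdeal A ^ 2 := by
  intro hle
  refine h (Submodule.eq_bot_of_le_smul_of_le_jacobson_bot (maximalIdeal A) (maximalIdeal A)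
    (Ideal.fg_of_isNoetherianRing _) ?_ (IsLocalRing.maximalIdeal_le_jacobson _))
  rwa [smul_eq_mul, ← pow_two]

/-- Prime avoidance in a local ring, with the square of the maximal ideal as the exceptional
ideal. -/
theorem exists_mem_maximalIdeal_notMem_sq (h : maximalIdeal A ≠ ⊥) {S : Set (Ideal A)}
    (hS : S.Finite) (hprime : ∀ P ∈ S, P.IsPrime) (hm : ∀ P ∈ S, P ≠ maximalIdeal A) :
    ∃ x ∈ maximalIdeal A, x ∉ maximalIdeal A ^ 2 ∧ ∀ P ∈ S, x ∉ P := by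
  by_contra! hcon
  have hsub : (maximalIdeal A : Set A) ⊆
      ⋃ i ∈ insert (maximalIdeal A ^ 2) S, (id i : Ideal A) := by
    intro x hx
    by_cases hx2 : x ∈ maximalIdeal A ^ 2
    · exact Set.mem_biUnion (Set.mem_insert _ _) hx2
    · obtain ⟨P, hP, hxP⟩ := hcon x hx hx2
      exact Set.mem_biUnion (Set.mem_insert_of_mem _ hP) hxP
  -- Prime avoidance tolerates two non-prime members; both slots are given to the square of the
  -- maximal ideal.
  obtain ⟨P, hP, hle⟩ := (Ideal.subset_union_prime_finite (hS.insert _) (maximalIdeal A ^ 2)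
    (maximalIdeal A ^ 2) (by
      intro i hi hi1 _
      exact hprime i (hi.resolve_left hi1))).1 hsub
  rcases hP with rfl | hP
  · exact maximalIdeal_not_le_sq h hle
  · exact hm P hP (((maximalIdeal.isMaximal A).eq_of_le (hprime P hP).ne_top hle).symm)

end Generators

/-! ### Regular local rings: quotients, and being a domain -/

section RegularLocal

open IsLocalRing

variable {A : Type*} [CommRing A]

/-- The embedding dimension drops by at least one, the Krull dimension by at most one. -/
theorem IsRegularLocalRing.quotient_span_singleton [IsRegularLocalRing A] {x : A}
    (hx : x ∈ maximalIdeal A) (hx2 : x ∉ maximalIdeal A ^ 2) :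
    IsRegularLocalRing (A ⧸ Ideal.span {x}) := by
  have := isLocalRing_quotient (A := A) (I := Ideal.span {x}) (by simpa [Ideal.span_le] using hx)
  refine .of_spanFinrank_maximalIdeal_le _ ?_
  have h1 := spanFinrank_maximalIdeal_quotient_add_one_le hx hx2
  have h2 := ringKrullDim_le_ringKrullDim_quotient_add_card (R := A) {x}
    (by simpa [IsLocalRing.ringJacobson_eq_maximalIdeal] using hx)
  rw [← IsRegularLocalRing.spanFinrank_maximalIdeal] at h2
  simp only [Finset.card_singleton, Nat.cast_one] at h2
  have h3 : ((maximalIdeal (A ⧸ Ideal.span {x})).spanFinrank : WithBot ℕ∞) + 1 ≤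
      ringKrullDim (A ⧸ Ideal.span {x}) + 1 := by
    rw [Finset.coe_singleton] at h2
    exact le_trans (by exact_mod_cast h1) h2
  exact (ENat.WithBot.add_le_add_one_right_iff).1 h3

theorem IsRegularLocalRing.of_quotient_span_singleton [IsLocalRing A] [IsNoetherianRing A] {x : A}
    (hx : x ∈ maximalIdeal A) (hreg : IsSMulRegular A x)
    [IsRegularLocalRing (A ⧸ Ideal.span {x})] : IsRegularLocalRing A := by
  refine .of_spanFinrank_maximalIdeal_le _ ?_
  rw [← ringKrullDim_quotient_span_singleton_succ_eq_ringKrullDim hreg hx,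
    ← IsRegularLocalRing.spanFinrank_maximalIdeal]
  exact_mod_cast spanFinrank_maximalIdeal_le_quotient_add_one hx

theorem maximalIdeal_eq_bot_of_spanFinrank [IsLocalRing A] [IsNoetherianRing A]
    (h : (maximalIdeal A).spanFinrank = 0) : maximalIdeal A = ⊥ :=
  (Submodule.spanFinrank_eq_zero_iff_eq_bot (Ideal.fg_of_isNoetherianRing _)).1 h

/-- Induction on the embedding dimension. For x outside m² and all minimal primes, A/x is a domain,
so (x) is prime and contains a minimal prime P. As x ∉ P, every element of P lies in xP, and
Nakayama gives P = 0. -/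
theorem IsRegularLocalRing.isDomain [h : IsRegularLocalRing A] : IsDomain A := by
  obtain ⟨n, hn⟩ : ∃ n, (maximalIdeal A).spanFinrank = n := ⟨_, rfl⟩
  induction n using Nat.strong_induction_on generalizing A with
  | _ n ih =>
  by_cases hbot : maximalIdeal A = ⊥
  · have : IsField A := IsLocalRing.isField_iff_maximalIdeal_eq.2 hbot
    exact this.isDomain
  have hfin : (minimalPrimes A).Finite := minimalPrimes.finite_of_isNoetherianRing A
  have hne : ∀ P ∈ minimalPrimes A, P ≠ maximalIdeal A := by
    rintro P hP rfl
    have h0 : (maximalIdeal A).height = 0 := Ideal.height_eq_zero_iff.2 hP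
    have h1 := IsLocalRing.maximalIdeal_height_eq_ringKrullDim (R := A)
    rw [h0, ← IsRegularLocalRing.spanFinrank_maximalIdeal] at h1
    exact hbot (maximalIdeal_eq_bot_of_spanFinrank (by exact_mod_cast h1.symm))
  obtain ⟨x, hx, hx2, hxP⟩ := exists_mem_maximalIdeal_notMem_sq hbot hfin
    (fun P hP ↦ hP.1.1) hne
  have := IsRegularLocalRing.quotient_span_singleton hx hx2
  have hlt := spanFinrank_maximalIdeal_quotient_add_one_le hx hx2
  have hdom : IsDomain (A ⧸ Ideal.span {x}) := ih _ (by omega) rfl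
  have hprime : (Ideal.span {x}).IsPrime := (Ideal.Quotient.isDomain_iff_prime _).1 hdom
  obtain ⟨P, hP, hPx⟩ := Ideal.exists_minimalPrimes_le (bot_le : (⊥ : Ideal A) ≤ Ideal.span {x})
  have hPp : P.IsPrime := hP.1.1
  have hP0 : P = ⊥ := by
    refine Submodule.eq_bot_of_le_smul_of_le_jacobson_bot (maximalIdeal A) P
      (Ideal.fg_of_isNoetherianRing _) ?_ (IsLocalRing.maximalIdeal_le_jacobson _)
    intro y hy
    obtain ⟨z, rfl⟩ := Ideal.mem_span_singleton.1 (hPx hy)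
    exact Submodule.smul_mem_smul hx ((hPp.mem_or_mem hy).resolve_left (hxP P hP))
  rw [hP0] at hPp
  exact IsDomain.of_bot_isPrime A

end RegularLocal

/-! ### Projective dimension and reduction modulo a regular element -/

section ProjectiveDimension

open IsLocalRing CategoryTheory

universe u

variable {A : Type u} [CommRing A]

theorem hasProjectiveDimensionLE_zero_iff (M : Type u) [AddCommGroup M] [Module A M] :
    HasProjectiveDimensionLE (ModuleCat.of A M) 0 ↔ Module.Projective A M := by
  rw [IsProjective.iff_projective, projective_iff_hasProjectiveDimensionLE_zero]

theorem hasProjectiveDimensionLE_succ_iff_of_exact {K F M : Type u} [AddCommGroup K] [Module A K]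
    [AddCommGroup F] [Module A F] [AddCommGroup M] [Module A M] [hF : Module.Projective A F]
    {f : K →ₗ[A] F} {g : F →ₗ[A] M} (hf : Function.Injective f) (hg : Function.Surjective g)
    (hfg : Function.Exact f g) (n : ℕ) :
    HasProjectiveDimensionLE (ModuleCat.of A M) (n + 1) ↔
      HasProjectiveDimensionLE (ModuleCat.of A K) n := by
  have hS := ModuleCat.shortComplex_shortExact
    (ModuleCat.shortComplexOfCompEqZero f g hfg.linearMap_comp_eq_zero) hfg hf hg
  exact hS.hasProjectiveDimensionLT_X₃_iff n ((IsProjective.iff_projective (R := A) F).1 hF)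

theorem hasProjectiveDimensionLE_succ_iff_ker {F M : Type u}
    [AddCommGroup F] [Module A F] [AddCommGroup M] [Module A M] [Module.Projective A F]
    {g : F →ₗ[A] M} (hg : Function.Surjective g) (n : ℕ) :
    HasProjectiveDimensionLE (ModuleCat.of A M) (n + 1) ↔
      HasProjectiveDimensionLE (ModuleCat.of A (LinearMap.ker g)) n :=
  hasProjectiveDimensionLE_succ_iff_of_exact (LinearMap.ker g).injective_subtype hg
    (LinearMap.exact_subtype_ker_map g) n

theorem hasProjectiveDimensionLE_congr {M N : Type u} [AddCommGroup M] [Module A M]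
    [AddCommGroup N] [Module A N] (e : M ≃ₗ[A] N) {n : ℕ}
    (h : HasProjectiveDimensionLE (ModuleCat.of A M) n) :
    HasProjectiveDimensionLE (ModuleCat.of A N) n :=
  hasProjectiveDimensionLT_of_iso e.toModuleIso (n + 1)

instance projective_quotSMulTop (x : A) (M : Type*) [AddCommGroup M] [Module A M]
    [Module.Projective A M] : Module.Projective (A ⧸ Ideal.span {x}) (QuotSMulTop x M) :=
  .of_equiv ((QuotSMulTop.equivQuotTensor x M).extendScalarsOfSurjective
    Ideal.Quotient.mk_surjective).symm

/-- If an element of the kernel equals x f, then x g(f) = 0, and regularity of x on M puts f itself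
in the kernel. Reduction modulo x thus preserves the syzygy sequence. -/
theorem quotSMulTop_map_subtype_ker_injective {F M : Type*} [AddCommGroup F] [Module A F]
    [AddCommGroup M] [Module A M] {g : F →ₗ[A] M} {x : A} (hx : IsSMulRegular M x) :
    Function.Injective (QuotSMulTop.map x (LinearMap.ker g).subtype) := by
  rw [injective_iff_map_eq_zero]
  intro k hk
  obtain ⟨k, rfl⟩ := Submodule.Quotient.mk_surjective _ k
  rw [QuotSMulTop.map_apply_mk, Submodule.Quotient.mk_eq_zero,
    Submodule.mem_smul_pointwise_iff_exists] at hk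
  obtain ⟨f, -, hf⟩ := hk
  have hgf : g f = 0 := by
    refine hx ?_
    simp only [smul_zero]
    rw [← map_smul, hf]
    exact k.2
  rw [Submodule.Quotient.mk_eq_zero, Submodule.mem_smul_pointwise_iff_exists]
  exact ⟨⟨f, hgf⟩, trivial, Subtype.ext hf⟩

theorem hasProjectiveDimensionLE_quotSMulTop_succ_iff {F M : Type u}
    [AddCommGroup F] [Module A F] [AddCommGroup M] [Module A M] [Module.Projective A F]
    {g : F →ₗ[A] M} (hg : Function.Surjective g) {x : A} (hx : IsSMulRegular M x) (n : ℕ) :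
    HasProjectiveDimensionLE (ModuleCat.of (A ⧸ Ideal.span {x}) (QuotSMulTop x M)) (n + 1) ↔
      HasProjectiveDimensionLE
        (ModuleCat.of (A ⧸ Ideal.span {x}) (QuotSMulTop x (LinearMap.ker g))) n := by
  let f' := (QuotSMulTop.map x (LinearMap.ker g).subtype).extendScalarsOfSurjective
    (Ideal.Quotient.mk_surjective (I := Ideal.span {x}))
  let g' := (QuotSMulTop.map x g).extendScalarsOfSurjective
    (Ideal.Quotient.mk_surjective (I := Ideal.span {x}))
  have h1 : Function.Injective f' := fun a b hab ↦
    quotSMulTop_map_subtype_ker_injective (g := g) hx hab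
  have h2 : Function.Surjective g' := QuotSMulTop.map_surjective x hg
  have h3 : Function.Exact f' g' :=
    QuotSMulTop.map_exact x (LinearMap.exact_subtype_ker_map g) hg
  have h4 : Module.Projective (A ⧸ Ideal.span {x}) (QuotSMulTop x F) := projective_quotSMulTop x F
  exact hasProjectiveDimensionLE_succ_iff_of_exact (hF := h4) h1 h2 h3 n

theorem IsSMulRegular.ker {F M : Type*} [AddCommGroup F] [Module A F] [AddCommGroup M]
    [Module A M] {x : A} (hx : IsSMulRegular F x) (g : F →ₗ[A] M) :
    IsSMulRegular (LinearMap.ker g) x :=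
  hx.of_injective _ (LinearMap.ker g).injective_subtype

theorem IsSMulRegular.of_projective {F : Type*} [AddCommGroup F] [Module A F]
    [Module.Projective A F] {x : A} (hx : IsSMulRegular A x) : IsSMulRegular F x := by
  obtain ⟨s, hs⟩ := Module.projective_def'.1 ‹Module.Projective A F›
  have hF : IsSMulRegular (F →₀ A) x := fun a b hab ↦
    Finsupp.ext fun i ↦ hx (DFunLike.congr_fun hab i)
  exact hF.of_injective s
    (Function.LeftInverse.injective (g := Finsupp.linearCombination A id) fun y ↦
      LinearMap.congr_fun hs y)

/-- Reduction modulo an element that is regular on the ring and the module does not increase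
the projective dimension. -/
theorem hasProjectiveDimensionLE_quotSMulTop {x : A} (hx : IsSMulRegular A x) {n : ℕ}
    {M : Type u} [AddCommGroup M] [Module A M] (hxM : IsSMulRegular M x)
    (h : HasProjectiveDimensionLE (ModuleCat.of A M) n) :
    HasProjectiveDimensionLE (ModuleCat.of (A ⧸ Ideal.span {x}) (QuotSMulTop x M)) n := by
  induction n generalizing M with
  | zero =>
    rw [hasProjectiveDimensionLE_zero_iff] at h ⊢
    infer_instance
  | succ n ih =>
    have hg := Finsupp.linearCombination_id_surjective A M
    rw [hasProjectiveDimensionLE_succ_iff_ker hg] at h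
    rw [hasProjectiveDimensionLE_quotSMulTop_succ_iff hg hxM]
    exact ih ((IsSMulRegular.of_projective hx).ker _) h

/-- Syzygies reduce the claim to n = 0, where projective means free over a local ring and freeness
modulo a regular element lifts. -/
theorem hasProjectiveDimensionLE_of_quotSMulTop [IsLocalRing A] [IsNoetherianRing A] {x : A}
    (hxm : x ∈ maximalIdeal A) (hx : IsSMulRegular A x) {n : ℕ}
    {M : Type u} [AddCommGroup M] [Module A M] [Module.Finite A M] (hxM : IsSMulRegular M x)
    (h : HasProjectiveDimensionLE (ModuleCat.of (A ⧸ Ideal.span {x}) (QuotSMulTop x M)) n) :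
    HasProjectiveDimensionLE (ModuleCat.of A M) n := by
  induction n generalizing M with
  | zero =>
    rw [hasProjectiveDimensionLE_zero_iff] at h ⊢
    have := isLocalRing_quotient (A := A) (I := Ideal.span {x})
      (by simpa [Ideal.span_le] using hxm)
    have : Module.Finite (A ⧸ Ideal.span {x}) (QuotSMulTop x M) :=
      Module.Finite.of_restrictScalars_finite A _ _
    have hfree : Module.Free (A ⧸ Ideal.span {x}) (QuotSMulTop x M) :=
      Module.free_of_flat_of_isLocalRing
    have := Module.finitePresentation_of_finite A M
    have := (Module.free_quotSMulTop_iff_free (R := A) (M := M)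
      (IsLocalRing.maximalIdeal_le_jacobson _ hxm) hxM).1 hfree
    infer_instance
  | succ n ih =>
    obtain ⟨F, _, _, _, _, g, hg⟩ := Module.exists_finite_presentation A M
    rw [hasProjectiveDimensionLE_succ_iff_ker hg]
    rw [hasProjectiveDimensionLE_quotSMulTop_succ_iff hg hxM] at h
    exact ih ((IsSMulRegular.of_projective hx).ker _) h

/-- The induction passes through A/x with x ∈ m \ m². It is applied to a syzygy rather than to M,
because x has to be regular on the module and this is automatic inside a projective module over a
domain. -/
theorem IsRegularLocalRing.hasProjectiveDimensionLE [IsRegularLocalRing A] {n : ℕ}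
    (hn : (maximalIdeal A).spanFinrank ≤ n) (M : Type u) [AddCommGroup M] [Module A M]
    [Module.Finite A M] : HasProjectiveDimensionLE (ModuleCat.of A M) n := by
  induction n generalizing A M with
  | zero =>
    have := (IsLocalRing.isField_iff_maximalIdeal_eq (R := A)).2
      (maximalIdeal_eq_bot_of_spanFinrank (by omega))
    let := this.toField
    rw [hasProjectiveDimensionLE_zero_iff]
    exact Module.Projective.of_free (R := A)
  | succ n ih =>
    obtain ⟨F, _, _, _, _, g, hg⟩ := Module.exists_finite_presentation A M
    rw [hasProjectiveDimensionLE_succ_iff_ker hg]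
    by_cases hbot : maximalIdeal A = ⊥
    · have := (IsLocalRing.isField_iff_maximalIdeal_eq (R := A)).2 hbot
      let := this.toField
      have : HasProjectiveDimensionLE (ModuleCat.of A (LinearMap.ker g)) 0 := by
        rw [hasProjectiveDimensionLE_zero_iff]
        exact Module.Projective.of_free (R := A)
      exact hasProjectiveDimensionLT_of_ge _ 1 (n + 1) (by omega)
    obtain ⟨x, hx, hx2, -⟩ := exists_mem_maximalIdeal_notMem_sq hbot Set.finite_empty
      (fun P hP ↦ hP.elim) (fun P hP ↦ hP.elim)
    have := IsRegularLocalRing.isDomain (A := A)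
    have hx0 : x ≠ 0 := by rintro rfl; exact hx2 (zero_mem _)
    have hreg : IsSMulRegular A x := IsSMulRegular.of_ne_zero hx0
    have := IsRegularLocalRing.quotient_span_singleton hx hx2
    have hlt := spanFinrank_maximalIdeal_quotient_add_one_le hx hx2
    refine hasProjectiveDimensionLE_of_quotSMulTop hx hreg
      ((IsSMulRegular.of_projective hreg).ker g) ?_
    have : Module.Finite (A ⧸ Ideal.span {x}) (QuotSMulTop x (LinearMap.ker g)) :=
      Module.Finite.of_restrictScalars_finite A _ _
    exact ih (A := A ⧸ Ideal.span {x}) (by omega) _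

end ProjectiveDimension

/-! ### Serre's criterion for regularity -/

section Serre

open IsLocalRing CategoryTheory

universe u

open scoped TensorProduct Pointwise

theorem quotient_one_tmul_eq_zero_iff {A M : Type*} [CommRing A] [AddCommGroup M] [Module A M]
    (I : Ideal A) (m : M) :
    ((1 : A ⧸ I) ⊗ₜ[A] m : (A ⧸ I) ⊗[A] M) = 0 ↔ m ∈ I • (⊤ : Submodule A M) := by
  rw [← Submodule.Quotient.mk_eq_zero,
    ← (TensorProduct.quotTensorEquivQuotSMul M I).symm.map_eq_zero_iff]
  rfl

variable {A : Type u} [CommRing A] [IsNoetherianRing A]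

theorem exists_ne_zero_of_mem_associatedPrimes {P : Ideal A} (h : P ∈ associatedPrimes A A) :
    ∃ s : A, s ≠ 0 ∧ ∀ a ∈ P, s * a = 0 := by
  obtain ⟨hP, s, hs⟩ := isAssociatedPrime_iff.1 (AssociatedPrimes.mem_iff.1 h)
  refine ⟨s, ?_, fun a ha ↦ ?_⟩
  · rintro rfl
    exact hP.ne_top (hs.trans (by simp))
  · rw [hs, Submodule.mem_colon_singleton] at ha
    rw [mul_comm]
    exact ha

variable [IsLocalRing A]

/-- Over a Noetherian local ring of depth zero, finite modules of finite projective dimension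
are free. -/
theorem free_of_hasProjectiveDimensionLE_of_smul_eq_zero {s : A} (hs0 : s ≠ 0)
    (hs : ∀ a ∈ maximalIdeal A, s * a = 0) {n : ℕ} {M : Type u} [AddCommGroup M] [Module A M]
    [Module.Finite A M] (h : HasProjectiveDimensionLE (ModuleCat.of A M) n) :
    Module.Free A M := by
  induction n generalizing M with
  | zero =>
    have := (hasProjectiveDimensionLE_zero_iff M).1 h
    exact Module.free_of_flat_of_isLocalRing
  | succ n ih =>
    obtain ⟨F, _, _, _, _, g, hg⟩ := Module.exists_finite_presentation A M
    rw [hasProjectiveDimensionLE_succ_iff_ker hg] at h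
    have hK := ih h
    -- It suffices that K → F stays injective modulo m. If k ∈ mF then sk = 0; as K is free, the
    -- coordinates of k are killed by s ≠ 0, hence are nonunits, and k ∈ mK.
    refine Module.free_of_lTensor_residueField_injective (LinearMap.ker g).subtype g hg
      (LinearMap.exact_subtype_ker_map g) ?_
    rw [injective_iff_map_eq_zero]
    intro z hz
    obtain ⟨k, rfl⟩ : ∃ k : LinearMap.ker g, (1 : ResidueField A) ⊗ₜ[A] k = z := by
      obtain ⟨k, hk⟩ := Submodule.Quotient.mk_surjective _
        (TensorProduct.quotTensorEquivQuotSMul (LinearMap.ker g) (maximalIdeal A) z)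
      exact ⟨k, (LinearEquiv.symm_apply_eq _).2 hk⟩
    have hkF : (k : F) ∈ maximalIdeal A • (⊤ : Submodule A F) :=
      (quotient_one_tmul_eq_zero_iff (maximalIdeal A) (k : F)).1 hz
    have hsk : s • k = 0 := by
      refine Subtype.ext ?_
      change s • (k : F) = 0
      generalize (k : F) = f at hkF
      induction hkF using Submodule.smul_induction_on' with
      | smul r hr m _ => rw [smul_smul, hs r hr, zero_smul]
      | add x _ y _ hx hy => rw [smul_add, hx, hy, add_zero]
    have hkm : k ∈ maximalIdeal A • (⊤ : Submodule A (LinearMap.ker g)) := by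
      let b := Module.Free.chooseBasis A (LinearMap.ker g)
      rw [← b.sum_repr k]
      refine Submodule.sum_mem _ fun i _ ↦ Submodule.smul_mem_smul (fun hu ↦ hs0 ?_) trivial
      have : s * b.repr k i = 0 := by
        rw [← smul_eq_mul, ← Finsupp.smul_apply, ← map_smul, hsk, map_zero, Finsupp.zero_apply]
      exact (hu.mul_left_eq_zero).1 this
    exact (quotient_one_tmul_eq_zero_iff (maximalIdeal A) k).2 hkm

/-- Otherwise the residue field would be free, so its annihilator, the maximal ideal, would vanish.
-/
theorem maximalIdeal_notMem_associatedPrimes {n : ℕ} (hbot : maximalIdeal A ≠ ⊥)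
    (h : HasProjectiveDimensionLE (ModuleCat.of A (A ⧸ maximalIdeal A)) n) :
    maximalIdeal A ∉ associatedPrimes A A := by
  intro hass
  obtain ⟨s, hs0, hs⟩ := exists_ne_zero_of_mem_associatedPrimes hass
  have hfree := free_of_hasProjectiveDimensionLE_of_smul_eq_zero hs0 hs h
  refine hbot (eq_bot_iff.2 fun a ha ↦ ?_)
  have hann : a ∈ Module.annihilator A (A ⧸ maximalIdeal A) := by
    rwa [Ideal.annihilator_quotient]
  have : Nontrivial (A ⧸ maximalIdeal A) :=
    Ideal.Quotient.nontrivial_iff.2 (maximalIdeal.isMaximal A).ne_top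
  rwa [Module.annihilator_eq_bot.2 inferInstance] at hann

/-- For `x` in the maximal ideal `m` but not in its square, the residue field of `A ⧸ x` is a
direct summand of `m ⧸ x m`. -/
theorem exists_retract_quotSMulTop_maximalIdeal {x : A} (hx : x ∈ maximalIdeal A)
    (hx2 : x ∉ maximalIdeal A ^ 2) [IsLocalRing (A ⧸ Ideal.span {x})] :
    ∃ (i : ((A ⧸ Ideal.span {x}) ⧸ maximalIdeal (A ⧸ Ideal.span {x})) →ₗ[A ⧸ Ideal.span {x}]
        QuotSMulTop x (maximalIdeal A))
      (r : QuotSMulTop x (maximalIdeal A) →ₗ[A ⧸ Ideal.span {x}]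
        ((A ⧸ Ideal.span {x}) ⧸ maximalIdeal (A ⧸ Ideal.span {x}))), r ∘ₗ i = LinearMap.id := by
  set A' := A ⧸ Ideal.span {x}
  let xb : QuotSMulTop x (maximalIdeal A) := Submodule.Quotient.mk ⟨x, hx⟩
  let i : (A' ⧸ maximalIdeal A') →ₗ[A'] QuotSMulTop x (maximalIdeal A) :=
    (maximalIdeal A').liftQ (LinearMap.toSpanSingleton A' _ xb) (by
      intro a ha
      rw [← map_mk_maximalIdeal, Ideal.mem_map_iff_of_surjective _ Ideal.Quotient.mk_surjective]
        at ha
      obtain ⟨a, ha, rfl⟩ := ha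
      change a • xb = 0
      rw [← Submodule.Quotient.mk_smul, Submodule.Quotient.mk_eq_zero,
        Submodule.mem_smul_pointwise_iff_exists]
      exact ⟨⟨a, ha⟩, trivial, Subtype.ext (mul_comm _ _)⟩)
  -- The retraction comes from a linear form on m/m² equal to 1 at the class of x; the inclusion `i`
  -- sends 1 to that of x in m/xm.
  obtain ⟨φ, hφ⟩ := Module.Projective.exists_dual_eq_one (ResidueField A)
    (x := (maximalIdeal A).toCotangent ⟨x, hx⟩)
    (fun h ↦ hx2 (((maximalIdeal A).toCotangent_eq_zero _).1 h))
  let c : ResidueField A →ₗ[A] (A' ⧸ maximalIdeal A') :=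
    (maximalIdeal A).liftQ (LinearMap.toSpanSingleton A _ 1) (by
      intro a ha
      change a • (Submodule.Quotient.mk (1 : A') : A' ⧸ maximalIdeal A') = 0
      rw [← Submodule.Quotient.mk_smul, Submodule.Quotient.mk_eq_zero, Algebra.smul_def, mul_one,
        ← map_mk_maximalIdeal]
      exact Ideal.mem_map_of_mem _ ha)
  let r₀ : QuotSMulTop x (maximalIdeal A) →ₗ[A] (A' ⧸ maximalIdeal A') :=
    (x • (⊤ : Submodule A (maximalIdeal A))).liftQ
      (c ∘ₗ φ.restrictScalars A ∘ₗ (maximalIdeal A).toCotangent) (by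
        intro m hm
        rw [Submodule.mem_smul_pointwise_iff_exists] at hm
        obtain ⟨m, -, rfl⟩ := hm
        rw [LinearMap.mem_ker, map_smul, ← algebraMap_smul A' x]
        have : algebraMap A A' x = 0 :=
          Ideal.Quotient.eq_zero_iff_mem.2 (Ideal.mem_span_singleton_self x)
        rw [this, zero_smul])
  let r : QuotSMulTop x (maximalIdeal A) →ₗ[A'] (A' ⧸ maximalIdeal A') :=
    r₀.extendScalarsOfSurjective Ideal.Quotient.mk_surjective
  refine ⟨i, r, ?_⟩
  refine Submodule.linearMap_qext _ (LinearMap.ext_ring ?_)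
  change r (i (Submodule.Quotient.mk 1)) = Submodule.Quotient.mk 1
  have h1 : i (Submodule.Quotient.mk 1) = xb := by
    change (1 : A') • xb = xb
    exact one_smul _ _
  rw [h1]
  change c (φ ((maximalIdeal A).toCotangent ⟨x, hx⟩)) = _
  rw [hφ]
  change (1 : A) • (1 : A' ⧸ maximalIdeal A') = 1
  exact one_smul _ _

/-- **Serre's criterion**: a Noetherian local ring whose residue field has finite projective
dimension is regular. -/
theorem isRegularLocalRing_of_hasProjectiveDimensionLE {n : ℕ}
    (h : HasProjectiveDimensionLE (ModuleCat.of A (A ⧸ maximalIdeal A)) n) :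
    IsRegularLocalRing A := by
  obtain ⟨e, he⟩ : ∃ e, (maximalIdeal A).spanFinrank = e := ⟨_, rfl⟩
  induction e using Nat.strong_induction_on generalizing A with
  | _ e ih =>
  by_cases hbot : maximalIdeal A = ⊥
  · have := (IsLocalRing.isField_iff_maximalIdeal_eq (R := A)).2 hbot
    let := this.toField
    exact inferInstanceAs (IsRegularLocalRing A)
  have hfin := associatedPrimes.finite A A
  have hne := maximalIdeal_notMem_associatedPrimes hbot h
  obtain ⟨x, hx, hx2, hxP⟩ := exists_mem_maximalIdeal_notMem_sq hbot hfin
    (fun P hP ↦ hP.isPrime) (fun P hP h ↦ hne (h ▸ hP))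
  have hreg : IsSMulRegular A x := by
    by_contra hcon
    have : x ∈ ⋃ p ∈ associatedPrimes A A, (p : Set A) := by
      rw [biUnion_associatedPrimes_eq_compl_regular]
      exact hcon
    simp only [Set.mem_iUnion] at this
    obtain ⟨P, hP, hxP'⟩ := this
    exact hxP P hP hxP'
  have := isLocalRing_quotient (A := A) (I := Ideal.span {x}) (by simpa [Ideal.span_le] using hx)
  have hlt := spanFinrank_maximalIdeal_quotient_add_one_le hx hx2
  -- Weakening the bound to n + 1 leaves the bound n for the syzygy m. The bound n then passes to
  -- m/xm over A/x and to its direct summand, the residue field; the induction is on the embedding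
  -- dimension, not on n.
  have h1 : HasProjectiveDimensionLE (ModuleCat.of A (A ⧸ maximalIdeal A)) (n + 1) :=
    hasProjectiveDimensionLT_of_ge _ (n + 1) (n + 2) (by omega)
  rw [hasProjectiveDimensionLE_succ_iff_ker (Submodule.mkQ_surjective _)] at h1
  have h2 : HasProjectiveDimensionLE (ModuleCat.of A (maximalIdeal A)) n :=
    hasProjectiveDimensionLE_congr (LinearEquiv.ofEq _ _ (Submodule.ker_mkQ _)) h1
  have h3 := hasProjectiveDimensionLE_quotSMulTop hreg
    (hreg.of_injective _ (maximalIdeal A).injective_subtype) h2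
  obtain ⟨i, r, hri⟩ := exists_retract_quotSMulTop_maximalIdeal hx hx2
  let R : Retract (ModuleCat.of (A ⧸ Ideal.span {x})
      ((A ⧸ Ideal.span {x}) ⧸ maximalIdeal (A ⧸ Ideal.span {x})))
      (ModuleCat.of (A ⧸ Ideal.span {x}) (QuotSMulTop x (maximalIdeal A))) :=
    { i := ModuleCat.ofHom i
      r := ModuleCat.ofHom r
      retract := by rw [← ModuleCat.ofHom_comp, hri]; rfl }
  have h4 := R.hasProjectiveDimensionLT (n + 1)
  have := ih _ (by omega) h4 rfl
  exact IsRegularLocalRing.of_quotient_span_singleton hx hreg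

end Serre

/-! ### Regularity localizes -/

section Localization

open IsLocalRing CategoryTheory

universe u

/-- A/p has finite projective dimension over A; localizing at p turns it into the residue field of
A_p, and Serre's criterion applies. -/
theorem IsRegularLocalRing.localization_atPrime {A : Type u} [CommRing A] [IsRegularLocalRing A]
    (p : Ideal A) [p.IsPrime] : IsRegularLocalRing (Localization.AtPrime p) := by
  have : IsNoetherianRing (Localization.AtPrime p) :=
    IsLocalization.isNoetherianRing p.primeCompl _ inferInstance
  have h := IsRegularLocalRing.hasProjectiveDimensionLE (A := A) le_rfl (A ⧸ p)
  have h1 := ModuleCat.localizedModule_hasProjectiveDimensionLE (maximalIdeal A).spanFinrank p.primeCompl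
    (ModuleCat.of A (A ⧸ p))
  let f := Submodule.toLocalizedQuotient' (Localization.AtPrime p) p.primeCompl
    (Algebra.linearMap A (Localization.AtPrime p)) p
  have := ModuleCat.localizedModule_isLocalizedModule (ModuleCat.of A (A ⧸ p)) p.primeCompl
  let e₀ := IsLocalizedModule.linearEquiv p.primeCompl
    ((ModuleCat.of A (A ⧸ p)).localizedModuleMkLinearMap p.primeCompl) f
  have e := e₀.extendScalarsOfIsLocalization p.primeCompl (Localization.AtPrime p)
  have hp : Submodule.localized' (Localization.AtPrime p) p.primeCompl
      (Algebra.linearMap A (Localization.AtPrime p)) p =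
      maximalIdeal (Localization.AtPrime p) := by
    rw [← Localization.AtPrime.map_eq_maximalIdeal, Ideal.localized'_eq_map]
  have h2 := hasProjectiveDimensionLE_congr
    (e.trans (Submodule.quotEquivOfEq _ _ hp)) h1
  exact isRegularLocalRing_of_hasProjectiveDimensionLE h2

end Localization

/-! ### Regular local rings are integrally closed -/

section Normality

open IsLocalRing

/-- Any x ∈ m \ m² is prime, since its quotient is a domain. If x ∤ z for some z ∈ m, write xb = yu
and zb = yw; then xw = zu, so x ∣ u, and cancelling x gives y ∣ b. -/
theorem IsRegularLocalRing.isPrincipal_maximalIdeal {C : Type*} [CommRing C]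
    [IsRegularLocalRing C] {y b : C} (hy : y ≠ 0) (hb : ¬ y ∣ b)
    (h : ∀ t ∈ maximalIdeal C, y ∣ t * b) : (maximalIdeal C).IsPrincipal := by
  have := IsRegularLocalRing.isDomain (A := C)
  by_cases hbot : maximalIdeal C = ⊥
  · rw [hbot]; infer_instance
  obtain ⟨x, hx, hx2, -⟩ := exists_mem_maximalIdeal_notMem_sq hbot Set.finite_empty
    (fun P hP ↦ hP.elim) (fun P hP ↦ hP.elim)
  have := IsRegularLocalRing.quotient_span_singleton hx hx2
  have := IsRegularLocalRing.isDomain (A := C ⧸ Ideal.span {x})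
  have hp : (Ideal.span {x}).IsPrime := (Ideal.Quotient.isDomain_iff_prime _).1 this
  have hx0 : x ≠ 0 := by rintro rfl; exact hx2 (zero_mem _)
  have hxp : Prime x := (Ideal.span_singleton_prime hx0).1 hp
  refine ⟨x, le_antisymm (fun z hz ↦ ?_) ((Ideal.span_singleton_le_iff_mem _).2 hx)⟩
  rw [Ideal.submodule_span_eq, Ideal.mem_span_singleton]
  by_contra hxz
  obtain ⟨u, hu⟩ := h x hx
  obtain ⟨w, hw⟩ := h z hz
  have h1 : x * w = z * u := by
    refine mul_left_cancel₀ hy ?_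
    linear_combination z * hu - x * hw
  obtain ⟨v, rfl⟩ := (hxp.dvd_or_dvd ⟨w, h1.symm⟩).resolve_left hxz
  refine hb ⟨v, mul_left_cancel₀ hx0 ?_⟩
  linear_combination hu

theorem dvd_algebraMap_atPrime_iff {A : Type*} [CommRing A] (P : Ideal A) [P.IsPrime] (y b : A) :
    algebraMap A (Localization.AtPrime P) y ∣ algebraMap A (Localization.AtPrime P) b ↔
      ∃ u ∉ P, y ∣ u * b := by
  rw [← Ideal.mem_span_singleton, ← Set.image_singleton, ← Ideal.map_span,
    ← IsLocalization.mk'_one (M := P.primeCompl),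
    IsLocalization.mk'_mem_map_algebraMap_iff P.primeCompl]
  simp only [Ideal.mem_span_singleton]
  rfl

theorem algebraMap_dvd_of_isIntegral_div {A C : Type*} [CommRing A] [IsDomain A] [CommRing C]
    [IsDomain C] [IsIntegrallyClosed C] [Algebra A C] (hinj : Function.Injective (algebraMap A C))
    {a y : A} (hy : y ≠ 0)
    (hx : IsIntegral A (algebraMap A (FractionRing A) a / algebraMap A (FractionRing A) y)) :
    algebraMap A C y ∣ algebraMap A C a := by
  have hinj' : Function.Injective (algebraMap A (FractionRing C)) := by
    rw [IsScalarTower.algebraMap_eq A C (FractionRing C)]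
    exact (IsFractionRing.injective C (FractionRing C)).comp hinj
  let φ : FractionRing A →ₐ[A] FractionRing C :=
    IsFractionRing.liftAlgHom (g := Algebra.ofId _ _) hinj'
  obtain ⟨c, hc⟩ := (isIntegrallyClosed_iff (FractionRing C)).1 inferInstance
    ((hx.map φ).tower_top (A := C))
  rw [map_div₀, φ.commutes, φ.commutes, eq_div_iff (by rwa [Ne, map_eq_zero_iff _ hinj']),
    IsScalarTower.algebraMap_apply A C (FractionRing C),
    IsScalarTower.algebraMap_apply A C (FractionRing C), ← map_mul] at hc
  exact ⟨c, (IsFractionRing.injective C (FractionRing C) (hc.symm.trans (by rw [mul_comm])))⟩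

/-- If a/y is integral and y ∤ a, choose an associated prime P = (y : b) of A/y containing (y : a).
In the regular ring A_P the maximal ideal is principal, so A_P is normal and y ∣ a there. Clearing
denominators gives u ∉ P with u ∈ (y : a) ⊆ P. -/
theorem IsRegularLocalRing.isIntegrallyClosed {A : Type*} [CommRing A] [IsRegularLocalRing A] :
    IsIntegrallyClosed A := by
  have := IsRegularLocalRing.isDomain (A := A)
  refine (isIntegrallyClosed_iff (FractionRing A)).2 fun {x} hx ↦ ?_
  obtain ⟨a, y, hy, rfl⟩ := IsFractionRing.div_surjective (A := A) x
  have hy0 : y ≠ 0 := nonZeroDivisors.ne_zero hy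
  suffices y ∣ a by
    obtain ⟨c, rfl⟩ := this
    refine ⟨c, ?_⟩
    have : algebraMap A (FractionRing A) y ≠ 0 := by simpa using hy0
    rw [map_mul]
    field_simp
  by_contra hya
  have hne : (Ideal.Quotient.mk (Ideal.span {y}) a) ≠ 0 := by
    rwa [Ne, Ideal.Quotient.eq_zero_iff_mem, Ideal.mem_span_singleton]
  obtain ⟨P, hP, hPa⟩ := exists_le_isAssociatedPrime_of_isNoetherianRing A _ hne
  have hcolon : ∀ t c : A, t ∈ (⊥ : Submodule A (A ⧸ Ideal.span {y})).colon
      {Ideal.Quotient.mk (Ideal.span {y}) c} ↔ y ∣ t * c := by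
    intro t c
    rw [Submodule.mem_colon_singleton, Submodule.mem_bot, ← Ideal.mem_span_singleton,
      ← Ideal.Quotient.eq_zero_iff_mem]
    rfl
  obtain ⟨hPp, b, hb⟩ := isAssociatedPrime_iff.1 hP
  obtain ⟨b, rfl⟩ := Ideal.Quotient.mk_surjective b
  have hbP : ∀ t, t ∈ P ↔ y ∣ t * b := fun t ↦ by rw [← hcolon, ← hb]
  have haP : ∀ t, y ∣ t * a → t ∈ P := fun t ht ↦ hPa ((hcolon t a).2 ht)
  let C := Localization.AtPrime P
  have : IsRegularLocalRing C := IsRegularLocalRing.localization_atPrime P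
  have := IsRegularLocalRing.isDomain (A := C)
  have hinj : Function.Injective (algebraMap A C) :=
    IsLocalization.injective C P.primeCompl_le_nonZeroDivisors
  have hpr : (maximalIdeal C).IsPrincipal := by
    refine IsRegularLocalRing.isPrincipal_maximalIdeal (y := algebraMap A C y)
      (b := algebraMap A C b) ?_ ?_ ?_
    · rwa [Ne, map_eq_zero_iff _ hinj]
    · rw [dvd_algebraMap_atPrime_iff]
      rintro ⟨u, hu, hyu⟩
      exact hu ((hbP u).2 hyu)
    · intro t ht
      rw [← Localization.AtPrime.map_eq_maximalIdeal] at ht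
      refine Submodule.span_induction ?_ (by simp) ?_ ?_ ht
      · rintro _ ⟨t, ht, rfl⟩
        rw [← map_mul]
        exact map_dvd _ ((hbP t).1 ht)
      · intro s t _ _ hs ht
        rw [add_mul]
        exact dvd_add hs ht
      · intro s t _ ht
        rw [smul_eq_mul, mul_assoc]
        exact ht.mul_left s
  have hC : IsIntegrallyClosed C :=
    ((tfae_of_isNoetherianRing_of_isLocalRing_of_isDomain C).out 3 4 rfl rfl).2 hpr |>.1
  have hdvd := algebraMap_dvd_of_isIntegral_div hinj hy0 hx
  rw [dvd_algebraMap_atPrime_iff] at hdvd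
  obtain ⟨u, hu, hyu⟩ := hdvd
  exact hu (haP u hyu)

end Normality

/-! ### Going down over a normal domain -/

section GoingDown

open Polynomial

/-- Over the fraction field of A/p, a monic divisor of a unit times a power of X is itself a power
of X. -/
theorem Polynomial.Monic.coeff_mem_of_dvd_C_mul_X_pow {A : Type*} [CommRing A] {p : Ideal A}
    [p.IsPrime] {m g : A[X]} (hm : m.Monic) (hdvd : m ∣ g) {c : A} (hc : c ∉ p) {N : ℕ}
    (hg : g.map (Ideal.Quotient.mk p) = C (Ideal.Quotient.mk p c) * X ^ N) {i : ℕ}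
    (hi : i < m.natDegree) : m.coeff i ∈ p := by
  let K := FractionRing (A ⧸ p)
  let φ : A →+* K := (algebraMap (A ⧸ p) K).comp (Ideal.Quotient.mk p)
  have hker : ∀ a, φ a = 0 ↔ a ∈ p := fun a ↦ by
    rw [RingHom.comp_apply, map_eq_zero_iff _ (IsFractionRing.injective (A ⧸ p) K),
      Ideal.Quotient.eq_zero_iff_mem]
  have h1 : m.map φ ∣ X ^ N := by
    have h2 : m.map φ ∣ g.map φ := Polynomial.map_dvd φ hdvd
    have h3 : g.map φ = C (φ c) * X ^ N := by
      rw [← Polynomial.map_map, hg]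
      simp [φ]
    rw [h3] at h2
    have hu : IsUnit (C (φ c)) := by
      rw [isUnit_C, isUnit_iff_ne_zero, Ne, hker]
      exact hc
    exact (hu.dvd_mul_left).1 h2
  obtain ⟨k, -, hk⟩ := (dvd_prime_pow Polynomial.prime_X N).1 h1
  have h4 : m.map φ = X ^ k := eq_of_monic_of_associated (hm.map φ) (monic_X_pow k) hk
  have h5 : k = m.natDegree := by
    rw [← hm.natDegree_map φ, h4, natDegree_X_pow]
  rw [← hker, ← coeff_map, h4, coeff_X_pow, if_neg (by omega)]

variable {A D : Type*} [CommRing A] [IsDomain A] [IsIntegrallyClosed A] [CommRing D] [IsDomain D]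
  [Algebra A D] [Module.Finite A D] [Module.IsTorsionFree A D]

/-- Since z = xs lies in pD, it is a root of a monic G with lower coefficients in p. Then s is a
root of G(xX), which is a nonzero constant times a power of X modulo p. By normality the minimal
polynomial of s divides it, so its lower coefficients lie in p and a power of s lies in pD ⊆ Q. -/
theorem mem_of_algebraMap_mul_mem_map {p : Ideal A} [p.IsPrime] {Q : Ideal D} [Q.IsPrime]
    (hpQ : p.map (algebraMap A D) ≤ Q) {x : A} (hx : x ∉ p) {s : D}
    (h : algebraMap A D x * s ∈ p.map (algebraMap A D)) : s ∈ Q := by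
  set z := algebraMap A D x * s with hz
  obtain ⟨G, hG, -, hGc, hG0⟩ :=
    LinearMap.exists_monic_and_natDegree_eq_and_coeff_mem_pow_and_aeval_eq_zero A
      (Algebra.lmul A D z) p (by
        rintro _ ⟨d, rfl⟩
        rw [Ideal.smul_top_eq_map]
        exact Ideal.mul_mem_right d _ h)
  have hGz : aeval z G = 0 := by
    have := congrArg (fun f : Module.End A D ↦ f 1) hG0
    simp only [Polynomial.aeval_algHom_apply] at this
    simpa using this
  let g : A[X] := G.comp (C x * X)
  have hgs : aeval s g = 0 := by
    rw [aeval_comp, map_mul, aeval_C, aeval_X]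
    exact hGz
  have hint : IsIntegral A s := Algebra.IsIntegral.isIntegral s
  have hdvd : minpoly A s ∣ g := minpoly.isIntegrallyClosed_dvd hint hgs
  have hGmap : G.map (Ideal.Quotient.mk p) = X ^ G.natDegree := by
    ext i
    rw [coeff_map, coeff_X_pow]
    split_ifs with hi
    · rw [hi, hG.coeff_natDegree, map_one]
    · rw [Ideal.Quotient.eq_zero_iff_mem]
      rcases lt_or_gt_of_ne hi with hi | hi
      · exact Ideal.pow_le_self (by omega) (hGc i)
      · rw [coeff_eq_zero_of_natDegree_lt hi]
        exact zero_mem _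
  have hgmap : g.map (Ideal.Quotient.mk p) =
      C (Ideal.Quotient.mk p (x ^ G.natDegree)) * X ^ G.natDegree := by
    rw [Polynomial.map_comp, hGmap]
    simp [mul_pow]
  have hxn : x ^ G.natDegree ∉ p := fun h ↦ hx (Ideal.IsPrime.mem_of_pow_mem ‹_› _ h)
  have hmon := minpoly.monic hint
  have h0 := minpoly.aeval A s
  rw [aeval_eq_sum_range, Finset.sum_range_succ, hmon.coeff_natDegree, one_smul] at h0
  refine Ideal.IsPrime.mem_of_pow_mem ‹_› (minpoly A s).natDegree (hpQ ?_)
  rw [eq_neg_of_add_eq_zero_right h0]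
  refine neg_mem (sum_mem fun i hi ↦ ?_)
  rw [Algebra.smul_def]
  exact Ideal.mul_mem_right _ _ (Ideal.mem_map_of_mem _
    (hmon.coeff_mem_of_dvd_C_mul_X_pow hdvd hxn hgmap (Finset.mem_range.1 hi)))

/-- **Going down** for finite domain extensions of an integrally closed domain. -/
theorem Algebra.HasGoingDown.of_isIntegrallyClosed : Algebra.HasGoingDown A D where
  exists_ideal_le_liesOver_of_lt {p} _ Q _ hlt := by
    have hpQ : p.map (algebraMap A D) ≤ Q := Ideal.map_le_iff_le_comap.2 hlt.le
    -- A prime containing pD and disjoint from (A \ p)(D \ Q) lies inside Q and contracts exactly to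
    -- p.
    let S : Submonoid D := p.primeCompl.map (algebraMap A D) ⊔ Q.primeCompl
    have hdisj : Disjoint (p.map (algebraMap A D) : Set D) (S : Set D) := by
      rw [Set.disjoint_left]
      intro d hd hdS
      obtain ⟨_, ⟨x, hx, rfl⟩, s, hs, rfl⟩ := Submonoid.mem_sup.1 hdS
      exact hs (mem_of_algebraMap_mul_mem_map hpQ hx hd)
    obtain ⟨P, hP, hpP, hPS⟩ := Ideal.exists_le_prime_disjoint _ S hdisj
    refine ⟨P, fun d hd ↦ ?_, hP, ⟨le_antisymm (Ideal.map_le_iff_le_comap.1 hpP) fun x hx ↦ ?_⟩⟩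
    · by_contra hdQ
      exact Set.disjoint_left.1 hPS hd (Submonoid.mem_sup_right hdQ)
    · by_contra hxp
      exact Set.disjoint_left.1 hPS hx (Submonoid.mem_sup_left ⟨x, hxp, rfl⟩)

end GoingDown

/-! ### Equidimensionality and heights -/

section Heights

open IsLocalRing

theorem ringKrullDim_le_of_isIntegral_of_injective {A D : Type*} [CommRing A] [CommRing D]
    [Algebra A D] [Algebra.IsIntegral A D] (hinj : Function.Injective (algebraMap A D)) :
    ringKrullDim A ≤ ringKrullDim D := by
  refine iSup_le fun l ↦ ?_
  obtain ⟨Q, -, hQ, hQl⟩ := Ideal.exists_ideal_over_prime_of_isIntegral l.head.asIdeal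
    (⊥ : Ideal D) (by
      rw [← RingHom.ker_eq_comap_bot, (RingHom.injective_iff_ker_eq_bot _).1 hinj]
      exact bot_le)
  have : Q.LiesOver (RelSeries.head l).asIdeal := ⟨hQl.symm⟩
  obtain ⟨L, hL, -⟩ := Ideal.exists_ltSeries_of_hasGoingUp l Q
  rw [← hL]
  exact le_iSup (fun l : LTSeries (PrimeSpectrum D) ↦ (l.length : WithBot ℕ∞)) L

theorem ringKrullDim_le_of_isIntegral (A D : Type*) [CommRing A] [CommRing D]
    [Algebra A D] [Algebra.IsIntegral A D] : ringKrullDim D ≤ ringKrullDim A :=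
  Order.krullDim_le_of_strictMono (PrimeSpectrum.comap (algebraMap A D)) fun _ _ h ↦
    Ideal.IsIntegral.comap_lt_comap h

variable {R' R : Type*} [CommRing R'] [CommRing R] [Algebra R' R]

/-- For 0 ≠ a ∈ r ∩ R' one would get dim R' ≤ dim R = dim R/r ≤ dim R'/(a) ≤ dim R' − 1. This makes
R' → R/r injective, as going down requires. -/
theorem IsEquidimensionalRing.under_eq_bot_of_mem_minimalPrimes [IsDomain R']
    [FiniteRingKrullDim R'] [Algebra.IsIntegral R' R]
    (hinj : Function.Injective (algebraMap R' R)) (hequi : IsEquidimensionalRing R) {r : Ideal R}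
    (hr : r ∈ minimalPrimes R) : r.under R' = ⊥ := by
  by_contra hne
  obtain ⟨a, ha, ha0⟩ := Submodule.exists_mem_ne_zero_of_ne_bot hne
  have h1 : ringKrullDim R' ≤ ringKrullDim (R ⧸ r) :=
    (ringKrullDim_le_of_isIntegral_of_injective hinj).trans (hequi r hr).ge
  have h2 : ringKrullDim (R ⧸ r) ≤ ringKrullDim (R' ⧸ r.under R') :=
    ringKrullDim_le_of_isIntegral (R' ⧸ r.under R') (R ⧸ r)
  have h3 : ringKrullDim (R' ⧸ r.under R') ≤ ringKrullDim (R' ⧸ Ideal.span {a}) :=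
    ringKrullDim_le_of_surjective
      (Ideal.Quotient.factor ((Ideal.span_singleton_le_iff_mem _).2 ha))
      (Ideal.Quotient.factor_surjective _)
  have h4 := ringKrullDim_quotient_succ_le_of_nonZeroDivisor (mem_nonZeroDivisors_of_ne_zero ha0)
  have h5 : ringKrullDim R' + 1 ≤ ringKrullDim R' :=
    (add_le_add_left (h1.trans (h2.trans h3)) 1).trans h4
  obtain ⟨n, hn⟩ : ∃ n : ℕ, ringKrullDim R' = n := by
    have hlt := ringKrullDim_lt_top (R := R')
    have hbot := ringKrullDim_ne_bot (R := R')
    generalize ringKrullDim R' = x at hlt hbot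
    lift x to ℕ∞ using hbot
    lift x to ℕ using by rintro rfl; exact hlt.ne rfl
    exact ⟨x, rfl⟩
  rw [hn] at h5
  exact absurd (by exact_mod_cast h5 : n + 1 ≤ n) (by omega)

/-- Going down gives a lower bound for heights in an equidimensional finite extension of a
normal domain. -/
theorem IsEquidimensionalRing.height_under_le_height [IsDomain R'] [IsIntegrallyClosed R']
    [IsNoetherianRing R'] [FiniteRingKrullDim R'] [Module.Finite R' R]
    (hinj : Function.Injective (algebraMap R' R)) (hequi : IsEquidimensionalRing R) (q : Ideal R)
    [q.IsPrime] : (q.under R').height ≤ q.height := by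
  obtain ⟨r, hr, hrq⟩ := Ideal.exists_minimalPrimes_le (bot_le : (⊥ : Ideal R) ≤ q)
  have hrp : r.IsPrime := hr.1.1
  have hbot := hequi.under_eq_bot_of_mem_minimalPrimes hinj hr
  have hinj' : Function.Injective (algebraMap R' (R ⧸ r)) := by
    rw [RingHom.injective_iff_ker_eq_bot, ← hbot, IsScalarTower.algebraMap_eq R' R (R ⧸ r),
      ← RingHom.comap_ker, Ideal.Quotient.algebraMap_eq, Ideal.mk_ker]
  have : Module.IsTorsionFree R' (R ⧸ r) :=
    Module.isTorsionFree_iff_algebraMap_injective.2 hinj'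
  have : Module.Finite R' (R ⧸ r) := Module.Finite.of_surjective
    (IsScalarTower.toAlgHom R' R (R ⧸ r)).toLinearMap Ideal.Quotient.mk_surjective
  have : IsNoetherianRing (R ⧸ r) := IsNoetherianRing.of_finite R' (R ⧸ r)
  have : Algebra.HasGoingDown R' (R ⧸ r) := Algebra.HasGoingDown.of_isIntegrallyClosed
  let Q : Ideal (R ⧸ r) := q.map (Ideal.Quotient.mk r)
  have hcomap : Q.comap (Ideal.Quotient.mk r) = q := by
    rw [Ideal.comap_map_of_surjective _ Ideal.Quotient.mk_surjective, ← RingHom.ker_eq_comap_bot,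
      Ideal.mk_ker, sup_eq_left.2 hrq]
  have hQ : Q.IsPrime := Ideal.map_isPrime_of_surjective Ideal.Quotient.mk_surjective (by simpa)
  have : Q.LiesOver (q.under R') := ⟨by
    rw [Ideal.under, Ideal.under, IsScalarTower.algebraMap_eq R' R (R ⧸ r), ← Ideal.comap_comap,
      Ideal.Quotient.algebraMap_eq, hcomap]⟩
  have h1 : (q.under R').height ≤ Q.height := by
    rw [Ideal.height_eq_height_add_of_liesOver_of_hasGoingDown (q.under R') Q]
    exact le_self_add
  refine h1.trans ?_
  have h2 := Order.height_le_height_apply_of_strictMono (PrimeSpectrum.comap (Ideal.Quotient.mk r))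
    (RingHom.strictMono_comap_of_surjective Ideal.Quotient.mk_surjective) ⟨Q, hQ⟩
  rw [← PrimeSpectrum.height_eq_orderHeight, ← PrimeSpectrum.height_eq_orderHeight,
    PrimeSpectrum.comap_asIdeal, hcomap] at h2
  exact h2

end Heights

/-! ### Upper bounds for Hilbert functions -/

section Length

open IsLocalRing

theorem Module.length_eq_length_add_length_quotient {A M : Type*} [Ring A] [AddCommGroup M]
    [Module A M] (N : Submodule A M) :
    Module.length A M = Module.length A N + Module.length A (M ⧸ N) :=
  Module.length_eq_add_of_exact N.subtype N.mkQ N.injective_subtype N.mkQ_surjective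
    (LinearMap.exact_subtype_mkQ N)

theorem Module.length_quotient_le_of_le {A M : Type*} [Ring A] [AddCommGroup M] [Module A M]
    {N P : Submodule A M} (h : N ≤ P) : Module.length A (M ⧸ P) ≤ Module.length A (M ⧸ N) :=
  Module.length_le_of_surjective (Submodule.factor h) (Submodule.factor_surjective h)

theorem Module.length_span_range_le {A M ι : Type*} [CommRing A] [AddCommGroup M]
    [Module A M] [Fintype ι] (v : ι → M) (I : Ideal A) (hI : ∀ a ∈ I, ∀ i, a • v i = 0) :
    Module.length A (Submodule.span A (Set.range v)) ≤
      Fintype.card ι * Module.length A (A ⧸ I) := by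
  classical
  let φ : (ι → A ⧸ I) →ₗ[A] M := LinearMap.lsum A (fun _ ↦ A ⧸ I) A fun i ↦
    Submodule.liftQ I (LinearMap.toSpanSingleton A M (v i)) fun a ha ↦ by simpa using hI a ha i
  have hφ : Submodule.span A (Set.range v) ≤ LinearMap.range φ := by
    rw [Submodule.span_le]
    rintro _ ⟨i, rfl⟩
    refine ⟨Pi.single i (Submodule.Quotient.mk 1), ?_⟩
    rw [LinearMap.lsum_piSingle, Submodule.liftQ_apply, LinearMap.toSpanSingleton_apply, one_smul]
  refine (Module.length_le_of_injective (Submodule.inclusion hφ)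
    (Submodule.inclusion_injective hφ)).trans ?_
  refine (Module.length_le_of_surjective φ.rangeRestrict φ.surjective_rangeRestrict).trans ?_
  simp

theorem Module.length_quotient_le_add_length_quotient_sup_span {A M ι : Type*} [CommRing A]
    [AddCommGroup M] [Module A M] [Fintype ι] (N : Submodule A M) (v : ι → M) (I : Ideal A)
    (hI : ∀ a ∈ I, ∀ i, a • v i ∈ N) :
    Module.length A (M ⧸ N) ≤ Fintype.card ι * Module.length A (A ⧸ I) +
      Module.length A (M ⧸ N ⊔ Submodule.span A (Set.range v)) := by
  let P := Submodule.span A (Set.range (N.mkQ ∘ v))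
  rw [Module.length_eq_length_add_length_quotient P]
  refine add_le_add (Module.length_span_range_le _ I fun a ha i ↦ ?_) ?_
  · exact (Submodule.Quotient.mk_eq_zero N).2 (hI a ha i)
  · refine Module.length_le_of_surjective (Submodule.liftQ _ (P.mkQ.comp N.mkQ) ?_) ?_
    · rw [sup_le_iff, Submodule.span_le]
      refine ⟨fun y hy ↦ ?_, ?_⟩
      · rw [LinearMap.mem_ker, LinearMap.comp_apply, Submodule.mkQ_apply N,
          (Submodule.Quotient.mk_eq_zero N).2 hy, map_zero]
      · rintro _ ⟨i, rfl⟩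
        exact (Submodule.Quotient.mk_eq_zero P).2 (Submodule.subset_span ⟨i, rfl⟩)
    · rw [← LinearMap.range_eq_top, Submodule.range_liftQ, LinearMap.range_eq_top]
      exact P.mkQ_surjective.comp N.mkQ_surjective

variable {B : Type*} [CommRing B]

theorem Ideal.span_range_pow_eq_span_range_sym {ι : Type*} (x : ι → B) (n : ℕ) :
    Ideal.span (Set.range x) ^ n =
      Ideal.span (Set.range fun s : Sym ι n ↦ ((s : Multiset ι).map x).prod) := by
  refine le_antisymm ?_ ?_
  · rw [Ideal.span, Submodule.span_pow, Submodule.span_le]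
    intro a ha
    obtain ⟨f, rfl⟩ := Set.mem_pow.1 ha
    choose g hg using fun i ↦ (f i).2
    refine Submodule.subset_span ⟨⟨((List.ofFn g : List ι) : Multiset ι), by simp⟩, ?_⟩
    simp [List.map_ofFn, Function.comp_def, hg]
  · rw [Ideal.span_le]
    rintro _ ⟨⟨s, rfl⟩, rfl⟩
    induction s using Multiset.induction_on with
    | empty => simp
    | cons a s ih =>
      simp only [Sym.coe_mk, Multiset.map_cons, Multiset.prod_cons,
        Multiset.card_cons, pow_succ', SetLike.mem_coe] at ih ⊢
      exact Ideal.mul_mem_mul (Ideal.subset_span ⟨a, rfl⟩) ih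

variable [IsLocalRing B]

/-- m^n/m^(n+1) is spanned over the residue field by the degree n monomials in h generators. -/
theorem length_quotient_maximalIdeal_pow_succ_le {h : ℕ} (x : Fin h → B)
    (hx : Ideal.span (Set.range x) = maximalIdeal B) (n : ℕ) :
    Module.length B (B ⧸ maximalIdeal B ^ (n + 1)) ≤
      Module.length B (B ⧸ maximalIdeal B ^ n) + h.multichoose n := by
  have hn := Ideal.span_range_pow_eq_span_range_sym x n
  rw [hx] at hn
  refine (Module.length_quotient_le_add_length_quotient_sup_span (maximalIdeal B ^ (n + 1))
    (fun s : Sym (Fin h) n ↦ ((s : Multiset (Fin h)).map x).prod) (maximalIdeal B)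
    fun a ha s ↦ ?_).trans ?_
  · rw [pow_succ', smul_eq_mul]
    refine Ideal.mul_mem_mul ha ?_
    rw [hn]
    exact Ideal.subset_span ⟨s, rfl⟩
  · rw [← Ideal.span, ← hn, sup_eq_right.2 (Ideal.pow_le_pow_right n.le_succ), add_comm,
      Sym.card_sym_eq_multichoose, Fintype.card_fin]
    have : IsSimpleModule B (B ⧸ maximalIdeal B) :=
      isSimpleModule_iff_isCoatom.2 (maximalIdeal.isMaximal B).out
    rw [Module.length_eq_one B (B ⧸ maximalIdeal B), mul_one]

theorem length_quotient_maximalIdeal_pow_le {h : ℕ} (x : Fin h → B)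
    (hx : Ideal.span (Set.range x) = maximalIdeal B) (n : ℕ) :
    Module.length B (B ⧸ maximalIdeal B ^ (n + 1)) ≤ (n + h).choose h := by
  rw [← Nat.sum_range_multichoose]
  induction n with
  | zero =>
    refine (length_quotient_maximalIdeal_pow_succ_le x hx 0).trans ?_
    have : Subsingleton (B ⧸ maximalIdeal B ^ 0) := by
      rw [pow_zero, Ideal.one_eq_top]; infer_instance
    simp
  | succ n ih =>
    refine (length_quotient_maximalIdeal_pow_succ_le x hx (n + 1)).trans ?_
    rw [Finset.sum_range_succ _ (n + 1)]
    push_cast at ih ⊢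
    gcongr

/-- Telescoped monomial count, bounding the increment of the Hilbert function over c steps; both
sides are sums because lengths live in `ℕ∞`. -/
theorem length_quotient_maximalIdeal_pow_add_le {h : ℕ} (x : Fin h → B)
    (hx : Ideal.span (Set.range x) = maximalIdeal B) (n c : ℕ) :
    Module.length B (B ⧸ maximalIdeal B ^ (n + 1 + c)) + (n + h).choose h ≤
      Module.length B (B ⧸ maximalIdeal B ^ (n + 1)) + (n + c + h).choose h := by
  induction c with
  | zero => rfl
  | succ c ih =>
    have h1 := length_quotient_maximalIdeal_pow_succ_le x hx (n + 1 + c)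
    have h2 : (n + (c + 1) + h).choose h = (n + c + h).choose h + h.multichoose (n + 1 + c) := by
      rw [← Nat.sum_range_multichoose, ← Nat.sum_range_multichoose,
        show n + (c + 1) + 1 = (n + c + 1) + 1 by ring, Finset.sum_range_succ _ (n + c + 1)]
      congr 2; ring
    rw [h2, Nat.cast_add, ← add_assoc, ← add_assoc]
    calc _ ≤ _ + (h.multichoose (n + 1 + c) : ℕ∞) + ((n + h).choose h : ℕ∞) := by gcongr
      _ = _ + ((n + h).choose h : ℕ∞) + (h.multichoose (n + 1 + c) : ℕ∞) := by ring
      _ ≤ _ := by gcongr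

/-- By Artin–Rees, fy ∈ m^(n+c) forces y ∈ m^n in a domain, so the image of multiplication by f on
B/m^(n+c) is at least as long as B/m^n. -/
theorem exists_length_quotient_sup_pow_add_le [IsNoetherianRing B] [IsDomain B] {f : B}
    (hf : f ≠ 0) : ∃ c₀ : ℕ, ∀ c ≥ c₀, ∀ n : ℕ,
      Module.length B (B ⧸ Ideal.span {f} ⊔ maximalIdeal B ^ (n + c)) +
        Module.length B (B ⧸ maximalIdeal B ^ n) ≤
      Module.length B (B ⧸ maximalIdeal B ^ (n + c)) := by
  obtain ⟨k, hk⟩ := Ideal.exists_pow_inf_eq_pow_smul (maximalIdeal B) (Ideal.span {f})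
  refine ⟨k, fun c hc n ↦ ?_⟩
  have key (y : B) (hy : f * y ∈ maximalIdeal B ^ (n + c)) : y ∈ maximalIdeal B ^ n := by
    have h1 : f * y ∈ maximalIdeal B ^ n * Ideal.span {f} := by
      have h2 : f * y ∈ (maximalIdeal B ^ (n + c) • ⊤ ⊓ Ideal.span {f} : Ideal B) :=
        ⟨by simpa using hy, Ideal.mul_mem_right _ _ (Ideal.mem_span_singleton_self f)⟩
      rw [hk (n + c) (by omega)] at h2
      exact Ideal.mul_mono (Ideal.pow_le_pow_right (by omega)) inf_le_right h2
    obtain ⟨z, hz, hzy⟩ := Ideal.mem_mul_span_singleton.1 h1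
    rwa [← mul_left_cancel₀ hf ((mul_comm f z).trans hzy)]
  let φ : B →ₗ[B] B ⧸ maximalIdeal B ^ (n + c) :=
    (Submodule.mkQ _).comp (LinearMap.toSpanSingleton B B f)
  rw [Module.length_eq_length_add_length_quotient (LinearMap.range φ), add_comm]
  refine add_le_add ?_ ?_
  · rw [← φ.quotKerEquivRange.length_eq]
    refine Module.length_quotient_le_of_le fun y hy ↦ key y ?_
    rw [LinearMap.mem_ker] at hy
    rw [mul_comm]
    exact (Submodule.Quotient.mk_eq_zero _).1 hy
  · refine Module.length_le_of_surjective (Submodule.liftQ _ (Submodule.factor le_sup_right) ?_) ?_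
    · rintro _ ⟨y, rfl⟩
      refine (Submodule.Quotient.mk_eq_zero _).2 (Ideal.mem_sup_left ?_)
      exact Ideal.mul_mem_left _ _ (Ideal.mem_span_singleton_self f)
    · rw [← LinearMap.range_eq_top, Submodule.range_liftQ, LinearMap.range_eq_top]
      exact Submodule.factor_surjective _

/-- If `f M` lies in a submodule generated by `r` elements, then the length of `M / m ^ n M` is
bounded by `r` times that of `B / m ^ n`, up to an error of lower order. -/
theorem exists_length_quotient_smul_top_add_le [IsNoetherianRing B] [IsDomain B] {M : Type*}
    [AddCommGroup M] [Module B M] [Module.Finite B M] {r h : ℕ} (x : Fin h → B)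
    (hx : Ideal.span (Set.range x) = maximalIdeal B) (v : Fin r → M) {f : B} (hf : f ≠ 0)
    (hfv : ∀ y : M, f • y ∈ Submodule.span B (Set.range v)) :
    ∃ c g : ℕ, ∀ n : ℕ,
      Module.length B (M ⧸ (maximalIdeal B ^ (n + c + 1) • ⊤ : Submodule B M)) +
        (g * (n + h).choose h : ℕ) ≤ ((r + g) * (n + c + h).choose h : ℕ) := by
  obtain ⟨g, w, hw⟩ := Module.Finite.exists_fin (R := B) (M := M)
  obtain ⟨c, hc⟩ := exists_length_quotient_sup_pow_add_le hf
  refine ⟨c, g, fun n ↦ ?_⟩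
  have e : n + c + 1 = n + 1 + c := by ring
  have h1 := hc c le_rfl (n + 1)
  have h2 := length_quotient_maximalIdeal_pow_add_le x hx n c
  have h3 := length_quotient_maximalIdeal_pow_le x hx n
  have h4 := length_quotient_maximalIdeal_pow_le x hx (n + c)
  rw [e] at h4 ⊢
  have h5 := Module.length_quotient_le_add_length_quotient_sup_span
    (maximalIdeal B ^ (n + 1 + c) • ⊤ : Submodule B M) v (maximalIdeal B ^ (n + 1 + c))
    fun a ha i ↦ Submodule.smul_mem_smul ha trivial
  -- Modulo the span of `v`, each of the g generators of M is killed by f, so what remains costs at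
  -- most g copies of B/((f) + m^(n+1+c)).
  have h6 := Module.length_quotient_le_add_length_quotient_sup_span
    ((maximalIdeal B ^ (n + 1 + c) • ⊤ : Submodule B M) ⊔ Submodule.span B (Set.range v)) w
    (Ideal.span {f} ⊔ maximalIdeal B ^ (n + 1 + c)) fun a ha i ↦ by
      obtain ⟨b, hb, a', ha', rfl⟩ := Submodule.mem_sup.1 ha
      obtain ⟨z, rfl⟩ := Ideal.mem_span_singleton'.1 hb
      rw [add_smul, mul_smul]
      exact add_mem (Submodule.mem_sup_right (Submodule.smul_mem _ _ (hfv _)))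
        (Submodule.mem_sup_left (Submodule.smul_mem_smul ha' trivial))
  have : Subsingleton (M ⧸ (maximalIdeal B ^ (n + 1 + c) • ⊤ : Submodule B M) ⊔
      Submodule.span B (Set.range v) ⊔ Submodule.span B (Set.range w)) := by
    rw [hw, sup_top_eq]
    infer_instance
  rw [Fintype.card_fin] at h5 h6
  rw [Module.length_eq_zero_iff.2 this, add_zero] at h6
  generalize Module.length B (M ⧸ (maximalIdeal B ^ (n + 1 + c) • ⊤ : Submodule B M)) = a at *
  generalize Module.length B (M ⧸ (maximalIdeal B ^ (n + 1 + c) • ⊤ : Submodule B M) ⊔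
    Submodule.span B (Set.range v)) = b at *
  generalize Module.length B (B ⧸ Ideal.span {f} ⊔ maximalIdeal B ^ (n + 1 + c)) = e₁ at *
  generalize Module.length B (B ⧸ maximalIdeal B ^ (n + 1 + c)) = l₁ at *
  generalize Module.length B (B ⧸ maximalIdeal B ^ (n + 1)) = l₀ at *
  generalize (n + h).choose h = s at *
  generalize (n + c + h).choose h = t at *
  lift l₀ to ℕ using ne_top_of_le_ne_top (ENat.natCast_ne_top _) h3
  lift l₁ to ℕ using ne_top_of_le_ne_top (ENat.natCast_ne_top _) h4
  lift e₁ to ℕ using by rintro rfl; simp at h1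
  norm_cast at h1 h2 h3 h4
  refine (add_le_add_left (h5.trans (add_le_add_right h6 _)) _).trans ?_
  norm_cast
  -- The length of B/((f) + m^(n+1+c)) is at most a c-step increment of the Hilbert function of B,
  -- hence at most C(n+c+h, h) − C(n+h, h), of order below n^h.
  have h7 : e₁ + s ≤ t := by omega
  nlinarith [Nat.mul_le_mul_left r h4, Nat.mul_le_mul_left g h7]

end Length

/-! ### Lower bound for Hilbert functions -/

section LowerBound

open IsLocalRing

universe u

theorem length_quotient_maximalIdeal_pow_quotient_le {A : Type*} [CommRing A] [IsLocalRing A]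
    (I : Ideal A) [IsLocalRing (A ⧸ I)] (n : ℕ) :
    Module.length (A ⧸ I) ((A ⧸ I) ⧸ maximalIdeal (A ⧸ I) ^ n) ≤
      Module.length A (A ⧸ I ⊔ maximalIdeal A ^ n) := by
  rw [← Module.length_eq_of_surjective (S := A) (R := A ⧸ I) Ideal.Quotient.mk_surjective]
  let φ : A →ₗ[A] (A ⧸ I) ⧸ maximalIdeal (A ⧸ I) ^ n :=
    (Algebra.linearMap A _)
  have hφ (a : A) : φ a = Ideal.Quotient.mk _ (Ideal.Quotient.mk I a) := rfl
  have hsurj : Function.Surjective φ :=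
    Ideal.Quotient.mk_surjective.comp Ideal.Quotient.mk_surjective
  refine Module.length_le_of_surjective (Submodule.liftQ _ φ ?_) ?_
  · rw [sup_le_iff]
    refine ⟨fun a ha ↦ ?_, fun a ha ↦ ?_⟩
    · rw [LinearMap.mem_ker, hφ, Ideal.Quotient.eq_zero_iff_mem.2 ha, map_zero]
    · rw [LinearMap.mem_ker, hφ, Ideal.Quotient.eq_zero_iff_mem, ← map_mk_maximalIdeal,
        ← Ideal.map_pow]
      exact Ideal.mem_map_of_mem _ ha
  · rwa [← LinearMap.range_eq_top, Submodule.range_liftQ, LinearMap.range_eq_top]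

theorem exists_isPrime_le_ringKrullDim_quotient {A : Type*} [CommRing A] {d : ℕ}
    (h : (d : WithBot ℕ∞) ≤ ringKrullDim A) :
    ∃ P : Ideal A, P.IsPrime ∧ (d : WithBot ℕ∞) ≤ ringKrullDim (A ⧸ P) := by
  obtain ⟨l, rfl⟩ := Order.le_krullDim_iff.1 h
  refine ⟨l.head.asIdeal, inferInstance, ?_⟩
  rw [ringKrullDim_quotient, Order.le_krullDim_iff]
  exact ⟨⟨l.length, fun i ↦ ⟨l i, LTSeries.head_le l i⟩, fun i ↦ l.step i⟩, rfl⟩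

/-- The length of `A / m ^ n` grows at least like `n ^ d` if `d ≤ dim A`. -/
theorem exists_choose_le_length_quotient_maximalIdeal_pow (d : ℕ) :
    ∀ (A : Type u) [CommRing A] [IsLocalRing A] [IsNoetherianRing A],
      (d : WithBot ℕ∞) ≤ ringKrullDim A → ∃ k, 0 < k ∧ ∀ j : ℕ,
        (j.choose d : ℕ∞) ≤ Module.length A (A ⧸ maximalIdeal A ^ (k * j + 1)) := by
  induction d with
  | zero =>
    intro A _ _ _ _
    -- The exponent k j + 1 is never 0, so the quotient is nonzero even at j = 0.
    refine ⟨1, one_pos, fun j ↦ ?_⟩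
    have : Nontrivial (A ⧸ maximalIdeal A ^ (1 * j + 1)) :=
      Ideal.Quotient.nontrivial_iff.2
        (ne_top_of_le_ne_top Ideal.IsPrime.ne_top' (Ideal.pow_le_self (Nat.succ_ne_zero _)))
    rw [Nat.choose_zero_right, Nat.cast_one, Order.one_le_iff_ne_zero]
    exact Module.length_pos.ne'
  | succ d ih =>
    intro A _ _ _ hd
    obtain ⟨P, hP, hdP⟩ := exists_isPrime_le_ringKrullDim_quotient hd
    have : IsLocalRing (A ⧸ P) := isLocalRing_quotient (le_maximalIdeal hP.ne_top)
    have hne : maximalIdeal (A ⧸ P) ≠ ⊥ := fun h ↦ by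
      rw [ringKrullDim_eq_zero_of_isField (isField_iff_maximalIdeal_eq.2 h)] at hdP
      exact absurd hdP (by norm_cast)
    obtain ⟨x, hx, hx0⟩ := Submodule.exists_mem_ne_zero_of_ne_bot hne
    have hx1 : Ideal.span {x} ≤ maximalIdeal (A ⧸ P) := (Ideal.span_singleton_le_iff_mem _).2 hx
    have := isLocalRing_quotient hx1
    have hdx : (d : WithBot ℕ∞) ≤ ringKrullDim ((A ⧸ P) ⧸ Ideal.span {x}) := by
      have h1 := ringKrullDim_le_ringKrullDim_quotient_add_card ({x} : Finset (A ⧸ P)) (by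
        rw [ringJacobson_eq_maximalIdeal]
        simpa using hx)
      rw [Finset.coe_singleton, Finset.card_singleton] at h1
      have hbot := ringKrullDim_ne_bot (R := (A ⧸ P) ⧸ Ideal.span {x})
      have h2 := hdP.trans h1
      generalize ringKrullDim ((A ⧸ P) ⧸ Ideal.span {x}) = e at h2 hbot ⊢
      lift e to ℕ∞ using hbot
      norm_cast at h2 ⊢
      push_cast at h2
      exact (ENat.add_le_add_iff_right ENat.one_ne_top).1 h2
    obtain ⟨k₁, hk₁, hl⟩ := ih _ hdx
    obtain ⟨c, hc⟩ := exists_length_quotient_sup_pow_add_le hx0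
    -- One step of size k = max c k₁ adds the length for the quotient by x, at least C(j, d) by
    -- induction on d; Pascal's rule sums these to C(j, d+1).
    refine ⟨max c k₁, lt_max_of_lt_right hk₁, fun j ↦ ?_⟩
    suffices h : ((j.choose (d + 1) : ℕ) : ℕ∞) ≤
        Module.length (A ⧸ P) ((A ⧸ P) ⧸ maximalIdeal (A ⧸ P) ^ (max c k₁ * j + 1)) from
      h.trans ((length_quotient_maximalIdeal_pow_quotient_le P _).trans
        (Module.length_quotient_le_of_le le_sup_right))
    induction j with
    | zero => simp
    | succ j ihj =>
      have h1 := hc (max c k₁) (le_max_left _ _) (max c k₁ * j + 1)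
      rw [show max c k₁ * (j + 1) + 1 = max c k₁ * j + 1 + max c k₁ by ring]
      refine le_trans ?_ h1
      rw [Nat.choose_succ_succ, Nat.cast_add]
      refine add_le_add ?_ ihj
      refine (hl j).trans ((length_quotient_maximalIdeal_pow_quotient_le _ _).trans
        (Module.length_quotient_le_of_le (sup_le_sup_left (Ideal.pow_le_pow_right ?_) _)))
      have := Nat.mul_le_mul_right j (le_max_right c k₁)
      omega

end LowerBound

/-! ### Comparison of leading terms -/

section Asymptotics

open IsLocalRing Filter Topology

theorem tendsto_choose_div_pow {a : ℕ → ℕ} {k : ℝ} (h : ℕ) (ha : Tendsto a atTop atTop)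
    (hk : Tendsto (fun j ↦ (a j : ℝ) / j) atTop (𝓝 k)) :
    Tendsto (fun j ↦ ((a j).choose h : ℝ) / (j : ℝ) ^ h) atTop (𝓝 (k ^ h / h.factorial)) := by
  have h1 := (isEquivalent_choose h).comp_tendsto ha
  have h2 : Tendsto (fun j ↦ ((a j : ℝ) ^ h / h.factorial) / (j : ℝ) ^ h) atTop
      (𝓝 (k ^ h / h.factorial)) :=
    ((hk.pow h).div_const _).congr fun j ↦ by rw [div_pow, div_right_comm]
  exact (h1.div (Asymptotics.IsEquivalent.refl (u := fun j : ℕ ↦ (j : ℝ) ^ h))).symm.tendsto_nhds h2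

theorem Polynomial.natDegree_le_of_abs_eval_div_pow_le (Q : Polynomial ℝ) (h : ℕ) (C : ℝ)
    (hQ : ∀ᶠ j : ℕ in atTop, |Q.eval (j : ℝ) / (j : ℝ) ^ h| ≤ C) : Q.natDegree ≤ h := by
  by_contra! hlt
  have h1 := (Polynomial.abs_div_tendsto_atTop_atTop_of_degree_gt Q (Polynomial.X ^ h) (by
    rw [Polynomial.degree_X_pow, Polynomial.degree_eq_natDegree (by rintro rfl; simp at hlt)]
    exact_mod_cast hlt) (by simp)).comp
      tendsto_natCast_atTop_atTop
  obtain ⟨j, hj, hj'⟩ := (hQ.and (h1.eventually_gt_atTop C)).exists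
  simp at hj'
  linarith

theorem Polynomial.tendsto_eval_div_pow (Q : Polynomial ℝ) (h : ℕ) (hQ : Q.natDegree = h) :
    Tendsto (fun j : ℕ ↦ Q.eval (j : ℝ) / (j : ℝ) ^ h) atTop (𝓝 (Q.coeff h)) := by
  subst hQ
  have h1 := Q.isEquivalent_atTop_lead.comp_tendsto (tendsto_natCast_atTop_atTop (R := ℝ))
  have h2 : Tendsto (fun j : ℕ ↦ Q.leadingCoeff * (j : ℝ) ^ Q.natDegree / (j : ℝ) ^ Q.natDegree)
      atTop (𝓝 Q.leadingCoeff) := by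
    refine tendsto_const_nhds.congr' ?_
    filter_upwards [eventually_gt_atTop 0] with j hj
    have : (j : ℝ) ≠ 0 := by positivity
    field_simp
  exact (h1.div (Asymptotics.IsEquivalent.refl
    (u := fun j : ℕ ↦ (j : ℝ) ^ Q.natDegree))).symm.tendsto_nhds h2

/-- The growth comparison behind the main theorem: a Hilbert polynomial `P` whose normalised
coefficient is already as large as the bound `r` leaves no room for a further contribution `X`
growing like `n ^ h`. -/
theorem false_of_hilbertPolynomial_add_le {P : Polynomial ℚ} {r h D c g k : ℕ} (hr : 0 < r)
    (hD : h ≤ D) (hP : (D.factorial : ℚ) * P.coeff D = r) {l X : ℕ → ℕ∞}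
    (hl : ∀ᶠ n : ℕ in atTop, ∃ m : ℕ, l n = m ∧ (m : ℚ) = P.eval (n : ℚ))
    (hX : ∀ j : ℕ, (j.choose h : ℕ∞) ≤ X (k * j)) (hk : 0 < k)
    (hle : ∀ n : ℕ, l (n + c) + X (n + c) + (g * (n + h).choose h : ℕ) ≤
      ((r + g) * (n + c + h).choose h : ℕ)) : False := by
  -- Everything is sampled at n = k j, where X is bounded below.
  let Q : Polynomial ℝ := (P.map (algebraMap ℚ ℝ)).comp (Polynomial.C (k : ℝ) * Polynomial.X)
  have hkj : Tendsto (fun j ↦ k * j) atTop atTop := tendsto_id.const_mul_atTop' hk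
  have hcoeff : Q.coeff D = k ^ D * (r / D.factorial) := by
    have h1 : P.coeff D = r / D.factorial := by rw [← hP]; field_simp
    rw [Polynomial.comp_C_mul_X_coeff, Polynomial.coeff_map, h1]
    simp [mul_comm]
  have hev : ∀ᶠ j : ℕ in atTop, 0 ≤ Q.eval (j : ℝ) ∧ Q.eval (j : ℝ) ≤
      (r + g) * (k * j + h).choose h - g * (k * j - c + h).choose h - j.choose h := by
    filter_upwards [hkj.eventually hl, hkj.eventually_ge_atTop c] with j ⟨m, hm, hmP⟩ hj
    have h1 := hle (k * j - c)
    rw [Nat.sub_add_cancel hj, hm] at h1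
    have h2 : m + j.choose h + g * (k * j - c + h).choose h ≤ (r + g) * (k * j + h).choose h := by
      have := (add_le_add_left (add_le_add_right (hX j) (m : ℕ∞)) _).trans h1
      exact_mod_cast this
    have h3 : Q.eval (j : ℝ) = m := by
      have : (m : ℝ) = ((P.eval ((k * j : ℕ) : ℚ) : ℚ) : ℝ) := by rw [← hmP]; norm_cast
      rw [this, Polynomial.eval_comp, Polynomial.eval_map_algebraMap]
      simpa using Polynomial.aeval_algebraMap_apply ℝ ((k * j : ℕ) : ℚ) P
    rw [h3]
    refine ⟨Nat.cast_nonneg _, ?_⟩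
    have h4 : ((m + j.choose h + g * (k * j - c + h).choose h : ℕ) : ℝ) ≤
      ((r + g) * (k * j + h).choose h : ℕ) := Nat.cast_le.2 h2
    push_cast at h4
    linarith
  have hdiv : Tendsto (fun j : ℕ ↦ ((k * j : ℕ) : ℝ) / j) atTop (𝓝 k) := by
    refine tendsto_const_nhds.congr' ?_
    filter_upwards [eventually_gt_atTop 0] with j hj
    have : (j : ℝ) ≠ 0 := by positivity
    push_cast
    field_simp
  have t1 : Tendsto (fun j ↦ ((k * j + h).choose h : ℝ) / (j : ℝ) ^ h) atTop
      (𝓝 ((k : ℝ) ^ h / h.factorial)) := by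
    refine tendsto_choose_div_pow h (tendsto_atTop_mono (fun _ ↦ Nat.le_add_right _ _) hkj) ?_
    have := hdiv.add (tendsto_const_div_atTop_nhds_zero_nat (h : ℝ))
    rw [add_zero] at this
    refine this.congr fun j ↦ ?_
    push_cast
    ring
  have t2 : Tendsto (fun j ↦ ((k * j - c + h).choose h : ℝ) / (j : ℝ) ^ h) atTop
      (𝓝 ((k : ℝ) ^ h / h.factorial)) := by
    refine tendsto_choose_div_pow h (tendsto_atTop_mono (fun _ ↦ Nat.le_add_right _ _)
      ((tendsto_sub_atTop_nat c).comp hkj)) ?_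
    have := hdiv.add (tendsto_const_div_atTop_nhds_zero_nat ((h : ℝ) - c))
    rw [add_zero] at this
    refine this.congr' ?_
    filter_upwards [hkj.eventually_ge_atTop c] with j hj
    push_cast [Function.comp_apply, Nat.cast_sub hj]
    ring
  have t3 : Tendsto (fun j : ℕ ↦ (j.choose h : ℝ) / (j : ℝ) ^ h) atTop
      (𝓝 ((1 : ℝ) ^ h / h.factorial)) := by
    refine tendsto_choose_div_pow h tendsto_id ?_
    refine tendsto_const_nhds.congr' ?_
    filter_upwards [eventually_gt_atTop 0] with j hj
    have : (j : ℝ) ≠ 0 := by positivity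
    simp [this]
  -- The two g-terms cancel in the limit, leaving (r k^h − 1)/h!.
  have t4 := ((t1.const_mul ((r : ℝ) + g)).sub (t2.const_mul (g : ℝ))).sub t3
  have hev' : ∀ᶠ j : ℕ in atTop, 0 ≤ Q.eval (j : ℝ) / (j : ℝ) ^ h ∧
      Q.eval (j : ℝ) / (j : ℝ) ^ h ≤ (r + g) * ((k * j + h).choose h / (j : ℝ) ^ h) -
        g * ((k * j - c + h).choose h / (j : ℝ) ^ h) - j.choose h / (j : ℝ) ^ h := by
    filter_upwards [hev] with j hj
    refine ⟨div_nonneg hj.1 (by positivity), ?_⟩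
    rw [← mul_div_assoc, ← mul_div_assoc, ← sub_div, ← sub_div]
    exact div_le_div_of_nonneg_right hj.2 (by positivity)
  have hnat : Q.natDegree ≤ h := by
    obtain ⟨C, hC⟩ := t4.isBoundedUnder_le
    rw [eventually_map] at hC
    refine Q.natDegree_le_of_abs_eval_div_pow_le h C ?_
    filter_upwards [hC, hev'] with j h1 h2
    rw [abs_of_nonneg h2.1]
    exact h2.2.trans h1
  have hne : Q.coeff D ≠ 0 := by rw [hcoeff]; positivity
  -- Only h ≤ D is assumed; the growth bound on Q and its nonzero coefficient in degree D give the
  -- converse.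
  have hDh : D = h := le_antisymm ((Polynomial.le_natDegree_of_ne_zero hne).trans hnat) hD
  subst hDh
  have hlim := le_of_tendsto_of_tendsto (Q.tendsto_eval_div_pow D
    (le_antisymm hnat (Polynomial.le_natDegree_of_ne_zero hne))) t4
    (hev'.mono fun j hj ↦ hj.2)
  rw [hcoeff, one_pow] at hlim
  have : (0 : ℝ) < 1 / D.factorial := by positivity
  have e : (k : ℝ) ^ D * (r / D.factorial) = r * (k ^ D / D.factorial) := by ring
  rw [e] at hlim
  nlinarith

end Asymptotics

/-! ### From the base change of R to its localizations over p' -/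

section Fiber

open IsLocalRing
open scoped TensorProduct

/-- Modulo the span of a maximal independent family, M is torsion and finite, so a single nonzero f
kills the quotient. -/
theorem exists_smul_mem_span_of_finrank {A M : Type*} [CommRing A] [IsDomain A] [AddCommGroup M]
    [Module A M] [Module.Finite A M] :
    ∃ (v : Fin (Module.finrank A M) → M) (f : A), f ≠ 0 ∧
      ∀ y : M, f • y ∈ Submodule.span A (Set.range v) := by
  obtain ⟨v, hv⟩ := exists_linearIndependent_of_le_finrank (le_refl (Module.finrank A M))
  have h1 := (Submodule.span A (Set.range v)).finrank_quotient_add_finrank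
  rw [finrank_span_eq_card hv, Fintype.card_fin] at h1
  have h2 := Module.finrank_eq_zero_iff_isTorsion.1
    (by omega : Module.finrank A (M ⧸ Submodule.span A (Set.range v)) = 0)
  obtain ⟨f, hf, hf0⟩ := Submodule.annihilator_top_inter_nonZeroDivisors h2
  refine ⟨v, f, nonZeroDivisors.ne_zero hf0, fun y ↦ ?_⟩
  rw [← Submodule.Quotient.mk_eq_zero]
  exact Submodule.mem_annihilator.1 hf (Submodule.Quotient.mk y) trivial

theorem smul_mem_span_tensorProduct {A B M ι : Type*} [CommRing A] [CommRing B] [Algebra A B]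
    [AddCommGroup M] [Module A M] (v : ι → M) (f : A)
    (hf : ∀ y : M, f • y ∈ Submodule.span A (Set.range v)) (y : B ⊗[A] M) :
    algebraMap A B f • y ∈ Submodule.span B (Set.range fun i ↦ (1 : B) ⊗ₜ[A] v i) := by
  induction y with
  | zero => simp
  | add y z hy hz => rw [smul_add]; exact add_mem hy hz
  | tmul b m =>
    rw [algebraMap_smul, ← TensorProduct.tmul_smul, ← mul_one b, ← smul_eq_mul,
      ← TensorProduct.smul_tmul']
    refine Submodule.smul_mem _ _ ?_
    have h1 : f • m ∈ ((Submodule.span B (Set.range fun i ↦ (1 : B) ⊗ₜ[A] v i)).restrictScalars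
        A).comap (TensorProduct.mk A B M 1) :=
      (Submodule.span_le.2 (by rintro _ ⟨i, rfl⟩; exact Submodule.subset_span ⟨i, rfl⟩)) (hf m)
    exact h1

variable {R' R B A : Type*} [CommRing R'] [CommRing R] [Algebra R' R]

/-- R/q is integral over R'/p', so a nonzero ideal contracts to a nonzero ideal. This trades
denominators in R for denominators in R'. -/
theorem exists_mul_eq_algebraMap_add [Algebra.IsIntegral R' R] (p' : Ideal R') (q : Ideal R)
    [q.IsPrime] [q.LiesOver p'] {s : R} (hs : s ∉ q) :
    ∃ a : R', a ∉ p' ∧ ∃ t : R, ∃ z ∈ q, t * s = algebraMap R' R a + z := by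
  have h1 := Ideal.comap_lt_comap_of_integral_mem_sdiff (R := R') (I := q)
    (J := q ⊔ Ideal.span {s}) le_sup_left
    ⟨Ideal.mem_sup_right (Ideal.mem_span_singleton_self s), hs⟩ (Algebra.IsIntegral.isIntegral s)
  obtain ⟨a, ha, ha'⟩ := SetLike.exists_of_lt h1
  refine ⟨a, fun h ↦ ha' ?_, ?_⟩
  · rwa [Ideal.LiesOver.over (P := q) (p := p')] at h
  · obtain ⟨z, hz, y, hy, hzy⟩ := Submodule.mem_sup.1 (Ideal.mem_comap.1 ha)
    obtain ⟨t, rfl⟩ := Ideal.mem_span_singleton'.1 hy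
    exact ⟨t, -z, neg_mem hz, by rw [← hzy]; ring⟩

variable [CommRing B] [Algebra R' B] [CommRing A] [Algebra R A] [Algebra R' A]
  [IsScalarTower R' R A] [Algebra B A] [IsScalarTower R' B A]

variable (R' R B) in
/-- The canonical map from the base change of `R` to a quotient of an algebra over both `B`
and `R`. -/
noncomputable def baseChangeToQuotient (I : Ideal A) : B ⊗[R'] R →ₐ[B] A ⧸ I :=
  Algebra.TensorProduct.lift (Algebra.ofId B (A ⧸ I)) (IsScalarTower.toAlgHom R' R (A ⧸ I))
    fun _ _ ↦ Commute.all _ _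

theorem baseChangeToQuotient_one_tmul (I : Ideal A) (s : R) :
    baseChangeToQuotient R' R B I (1 ⊗ₜ s) = algebraMap R (A ⧸ I) s := by
  simp [baseChangeToQuotient]

variable [IsLocalRing A]

theorem smul_top_le_ker_baseChangeToQuotient [IsLocalRing B] [IsLocalHom (algebraMap B A)] (n : ℕ) :
    (maximalIdeal B ^ n • ⊤ : Submodule B (B ⊗[R'] R)) ≤
      LinearMap.ker (baseChangeToQuotient R' R B (maximalIdeal A ^ n)).toLinearMap := by
  rw [Submodule.smul_le]
  intro a ha y _
  rw [LinearMap.mem_ker, map_smul, Algebra.smul_def,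
    IsScalarTower.algebraMap_apply B A, Ideal.Quotient.algebraMap_eq,
    Ideal.Quotient.eq_zero_iff_mem.2, zero_mul]
  refine Ideal.pow_right_mono (map_maximalIdeal_le (algebraMap B A)) n ?_
  rw [← Ideal.map_pow]
  exact Ideal.mem_map_of_mem _ ha

theorem algebraMap_pow_eq_zero (q : Ideal R) [q.IsPrime] [IsLocalization.AtPrime A q] {z : R}
    (hz : z ∈ q) (n : ℕ) : algebraMap R (A ⧸ maximalIdeal A ^ n) z ^ n = 0 := by
  rw [IsScalarTower.algebraMap_apply R A, ← map_pow, Ideal.Quotient.algebraMap_eq,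
    Ideal.Quotient.eq_zero_iff_mem]
  exact Ideal.pow_mem_pow ((IsLocalization.AtPrime.to_map_mem_maximal_iff A q z).2 hz) n

variable [Algebra.IsIntegral R' R] (p' : Ideal R') [p'.IsPrime] [IsLocalization.AtPrime B p']
  (q : Ideal R) [q.IsPrime] [q.LiesOver p'] [IsLocalization.AtPrime A q]

include p' q in
theorem baseChangeToQuotient_surjective (n : ℕ) :
    Function.Surjective (baseChangeToQuotient R' R B (maximalIdeal A ^ n)) := by
  set φ := baseChangeToQuotient R' R B (maximalIdeal A ^ n) with hφ
  intro y
  obtain ⟨y, rfl⟩ := Ideal.Quotient.mk_surjective y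
  obtain ⟨r, s, rfl⟩ := IsLocalization.exists_mk'_eq q.primeCompl y
  obtain ⟨a, ha, t, z, hz, hts⟩ := exists_mul_eq_algebraMap_add p' q s.2
  have hmem (w : R) : algebraMap R (A ⧸ maximalIdeal A ^ n) w ∈ φ.range :=
    ⟨1 ⊗ₜ w, baseChangeToQuotient_one_tmul _ w⟩
  -- Modulo a power of the maximal ideal, ts = a + z is a unit of B plus a nilpotent, so its inverse
  -- already lies in the image.
  have hunit : IsUnit (⟨_, hmem (t * s)⟩ : φ.range) := by
    have e : (⟨_, hmem (t * s)⟩ : φ.range) =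
        algebraMap B φ.range (algebraMap R' B a) + ⟨_, hmem z⟩ := by
      refine Subtype.ext ?_
      change algebraMap R _ (t * s) = algebraMap B (A ⧸ maximalIdeal A ^ n) (algebraMap R' B a) +
        algebraMap R _ z
      rw [hts, map_add, ← IsScalarTower.algebraMap_apply, ← IsScalarTower.algebraMap_apply]
    rw [e]
    refine IsNilpotent.isUnit_add_left_of_commute
      ⟨n, Subtype.ext (algebraMap_pow_eq_zero q hz n)⟩ ?_ (Commute.all _ _)
    exact (IsLocalization.map_units B (⟨a, ha⟩ : p'.primeCompl)).map _
  obtain ⟨⟨_, w, rfl⟩, hu⟩ := hunit.exists_left_inv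
  replace hu : φ w * algebraMap R _ (t * s) = 1 := congrArg Subtype.val hu
  refine ⟨w * 1 ⊗ₜ (t * r), ?_⟩
  rw [map_mul, baseChangeToQuotient_one_tmul]
  have hr : algebraMap R (A ⧸ maximalIdeal A ^ n) r = algebraMap R _ s *
      Ideal.Quotient.mk (maximalIdeal A ^ n) (IsLocalization.mk' A r s) := by
    rw [IsScalarTower.algebraMap_apply R A (A ⧸ maximalIdeal A ^ n),
      IsScalarTower.algebraMap_apply R A (A ⧸ maximalIdeal A ^ n), Ideal.Quotient.algebraMap_eq, ← map_mul, IsLocalization.mk'_spec']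
  rw [map_mul, hr]
  rw [map_mul] at hu
  linear_combination Ideal.Quotient.mk (maximalIdeal A ^ n) (IsLocalization.mk' A r s) * hu

variable [IsLocalRing B] [IsLocalHom (algebraMap B A)]

include p' q in
theorem length_quotient_le_length_tensorProduct (n : ℕ) :
    Module.length B (A ⧸ maximalIdeal A ^ n) ≤
      Module.length B ((B ⊗[R'] R) ⧸ (maximalIdeal B ^ n • ⊤ : Submodule B (B ⊗[R'] R))) := by
  refine Module.length_le_of_surjective
    (Submodule.liftQ _ _ (smul_top_le_ker_baseChangeToQuotient n)) ?_
  rw [← LinearMap.range_eq_top, Submodule.range_liftQ, LinearMap.range_eq_top]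
  exact baseChangeToQuotient_surjective p' q n

variable (q₂ : Ideal R) [q₂.IsPrime] [q₂.LiesOver p'] {A₂ : Type*} [CommRing A₂] [Algebra R A₂]
  [IsLocalization.AtPrime A₂ q₂] [IsLocalRing A₂] [Algebra R' A₂] [IsScalarTower R' R A₂]
  [Algebra B A₂] [IsScalarTower R' B A₂] [IsLocalHom (algebraMap B A₂)]

include p' q q₂ in
theorem length_quotient_add_le_length_tensorProduct (hne : q ≠ q₂) (n : ℕ) :
    Module.length B (A ⧸ maximalIdeal A ^ n) + Module.length B (A₂ ⧸ maximalIdeal A₂ ^ n) ≤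
      Module.length B ((B ⊗[R'] R) ⧸ (maximalIdeal B ^ n • ⊤ : Submodule B (B ⊗[R'] R))) := by
  set φ := baseChangeToQuotient R' R B (maximalIdeal A ^ n) with hφ
  set ψ := baseChangeToQuotient R' R B (maximalIdeal A₂ ^ n) with hψ
  rw [← Module.length_prod]
  have hker : (maximalIdeal B ^ n • ⊤ : Submodule B (B ⊗[R'] R)) ≤
      LinearMap.ker (φ.toLinearMap.prod ψ.toLinearMap) := by
    rw [LinearMap.ker_prod]
    exact le_inf (smul_top_le_ker_baseChangeToQuotient n) (smul_top_le_ker_baseChangeToQuotient n)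
  refine Module.length_le_of_surjective (Submodule.liftQ _ _ hker) ?_
  rw [← LinearMap.range_eq_top, Submodule.range_liftQ, LinearMap.range_eq_top]
  have hφs : Function.Surjective φ := baseChangeToQuotient_surjective p' q n
  have hψs : Function.Surjective ψ := baseChangeToQuotient_surjective p' q₂ n
  -- Chinese remainder argument: by incomparability q₂ ⊄ q, and a multiple of s^n maps to 1 in the
  -- first factor and to 0 in the second.
  obtain ⟨s, hs, hsq⟩ : ∃ s ∈ q₂, s ∉ q := by
    refine Set.not_subset.1 fun (h : q₂ ≤ q) ↦ ?_
    have h1 := Ideal.IsIntegral.comap_lt_comap (R := R') (lt_of_le_of_ne h hne.symm)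
    exact h1.ne ((Ideal.LiesOver.over (P := q₂) (p := p')).symm.trans
      (Ideal.LiesOver.over (P := q) (p := p')))
  obtain ⟨u, hu⟩ : ∃ u, φ (1 ⊗ₜ s) ^ n * u = 1 := by
    refine (IsUnit.pow n ?_).exists_right_inv
    rw [baseChangeToQuotient_one_tmul, IsScalarTower.algebraMap_apply R A]
    exact (IsLocalization.map_units A (⟨s, hsq⟩ : q.primeCompl)).map _
  obtain ⟨w, rfl⟩ := hφs u
  have h0 : ψ (1 ⊗ₜ s) ^ n = 0 := by
    rw [baseChangeToQuotient_one_tmul, algebraMap_pow_eq_zero q₂ hs]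
  rintro ⟨y₁, y₂⟩
  obtain ⟨w₁, rfl⟩ := hφs y₁
  obtain ⟨w₂, rfl⟩ := hψs y₂
  refine ⟨(1 ⊗ₜ s) ^ n * w * w₁ + (1 - (1 ⊗ₜ s) ^ n * w) * w₂, Prod.ext ?_ ?_⟩
  · change φ _ = _
    simp only [map_add, map_mul, map_sub, map_one, map_pow, hu]
    ring
  · change ψ _ = _
    simp only [map_add, map_mul, map_sub, map_one, map_pow, h0]
    ring

end Fiber

/-! ### Conclusion -/

section Main

open IsLocalRing Filter
open scoped TensorProduct

theorem coe_moduleDim_self (A : Type*) [CommRing A] [IsLocalRing A] [IsNoetherianRing A] :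
    (moduleDim A A : WithBot ℕ∞) = ringKrullDim A := by
  rw [moduleDim, Module.supportDim_self_eq_ringKrullDim]
  have hlt := ringKrullDim_lt_top (R := A)
  have hbot := ringKrullDim_ne_bot (R := A)
  generalize ringKrullDim A = x at hlt hbot
  lift x to ℕ∞ using hbot
  lift x to ℕ using by rintro rfl; exact hlt.ne rfl
  rfl

/-- A nonzero multiplicity excludes the default value 0, so a Hilbert polynomial exists. -/
theorem exists_hilbertPolynomial_of_localMultiplicity {A : Type*} [CommRing A] [IsLocalRing A]
    {r : ℚ} (hr : r ≠ 0) (h : localMultiplicity A = r) :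
    ∃ P : Polynomial ℚ, (∀ᶠ n : ℕ in atTop, ∃ m : ℕ,
      Module.length A (A ⧸ maximalIdeal A ^ (n + 1)) = m ∧ (m : ℚ) = P.eval (n : ℚ)) ∧
      ((moduleDim A A).factorial : ℚ) * P.coeff (moduleDim A A) = r := by
  rw [localMultiplicity, idealMultiplicity] at h
  split_ifs at h with hP
  · refine ⟨hP.choose, hP.choose_spec.mono fun n ⟨l, hl, hlP⟩ ↦ ⟨l, ?_, hlP⟩, h⟩
    rw [← hl]
    exact (Submodule.quotEquivOfEq _ _ (by rw [smul_eq_mul, Ideal.mul_top])).length_eq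
  · exact absurd h.symm hr

theorem IsRegularLocalRing.exists_span_range_eq_maximalIdeal (B : Type*) [CommRing B]
    [IsRegularLocalRing B] : ∃ (h : ℕ) (x : Fin h → B), (h : WithBot ℕ∞) = ringKrullDim B ∧
      Ideal.span (Set.range x) = maximalIdeal B := by
  obtain ⟨s, hs, hspan⟩ := Submodule.FG.exists_span_finset_card_eq_spanFinrank
    (IsNoetherian.noetherian (maximalIdeal B))
  refine ⟨_, fun i ↦ (s.equivFin.symm i : B), ?_, ?_⟩
  · rw [hs, IsRegularLocalRing.spanFinrank_maximalIdeal]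
  · rw [← hspan, Ideal.span]
    congr 1
    ext y
    simp only [Set.mem_range]
    exact ⟨by rintro ⟨i, rfl⟩; exact (s.equivFin.symm i).2,
      fun hy ↦ ⟨s.equivFin ⟨y, hy⟩, by simp⟩⟩

theorem length_le_length_of_isLocalHom (B A M : Type*) [CommRing B] [CommRing A] [IsLocalRing B]
    [IsLocalRing A] [Algebra B A] [IsLocalHom (algebraMap B A)] [AddCommGroup M] [Module B M]
    [Module A M] [IsScalarTower B A M] : Module.length A M ≤ Module.length B M := by
  rw [length_restrictScalars B A M]
  exact le_mul_of_one_le_right' (Order.one_le_iff_ne_zero.2 Module.length_pos.ne')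

variable {R' R : Type*} [CommRing R'] [IsRegularLocalRing R'] [CommRing R] [Algebra R' R]
  [Module.Finite R' R]

/-- If `A` has multiplicity `rank R`, then the length of the powers of the maximal ideal of `A`
and that of a further module `X` of growth `n ^ h` do not both fit into `R_{p'} / m ^ n R_{p'}`. -/
theorem false_of_length_add_le (hinj : Function.Injective (algebraMap R' R)) (p' : Ideal R')
    [p'.IsPrime] {A : Type*} [CommRing A] [IsLocalRing A] [IsNoetherianRing A]
    (hmult : localMultiplicity A = (Module.finrank R' R : ℚ)) {h k : ℕ}
    (hh : (h : WithBot ℕ∞) = ringKrullDim (Localization.AtPrime p'))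
    (hA : (h : WithBot ℕ∞) ≤ ringKrullDim A) (hk : 0 < k) (X : ℕ → ℕ∞)
    (hX : ∀ j : ℕ, (j.choose h : ℕ∞) ≤ X (k * j + 1))
    (hle : ∀ n : ℕ, Module.length A (A ⧸ maximalIdeal A ^ n) + X n ≤
      Module.length (Localization.AtPrime p') ((Localization.AtPrime p' ⊗[R'] R) ⧸
        (maximalIdeal (Localization.AtPrime p') ^ n • ⊤ :
          Submodule (Localization.AtPrime p') (Localization.AtPrime p' ⊗[R'] R)))) : False := by
  have hB := IsRegularLocalRing.localization_atPrime p'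
  have : IsDomain R' := IsRegularLocalRing.isDomain
  have : IsDomain (Localization.AtPrime p') := IsRegularLocalRing.isDomain
  obtain ⟨h', x, hh', hx⟩ :=
    IsRegularLocalRing.exists_span_range_eq_maximalIdeal (Localization.AtPrime p')
  obtain rfl : h' = h := by exact_mod_cast hh'.trans hh.symm
  obtain ⟨v, f, hf, hfv⟩ := exists_smul_mem_span_of_finrank (A := R') (M := R)
  have hf' : algebraMap R' (Localization.AtPrime p') f ≠ 0 :=
    (map_ne_zero_iff _ (IsLocalization.injective _ p'.primeCompl_le_nonZeroDivisors)).2 hf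
  obtain ⟨c, g, hcg⟩ := exists_length_quotient_smul_top_add_le x hx
    (fun i ↦ (1 : Localization.AtPrime p') ⊗ₜ[R'] v i) hf' (smul_mem_span_tensorProduct v f hfv)
  -- In rank zero the span would be trivial and f · 1 = 0, against injectivity.
  have hr : 0 < Module.finrank R' R := by
    by_contra h0
    have : IsEmpty (Fin (Module.finrank R' R)) := by
      rw [Nat.eq_zero_of_not_pos h0]; infer_instance
    have h1 := hfv 1
    rw [Set.range_eq_empty, Submodule.span_empty, Submodule.mem_bot, ← Algebra.algebraMap_eq_smul_one,
      map_eq_zero_iff _ hinj] at h1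
    exact hf h1
  obtain ⟨P, hP, hPr⟩ :=
    exists_hilbertPolynomial_of_localMultiplicity (by exact_mod_cast hr.ne') hmult
  refine false_of_hilbertPolynomial_add_le (X := fun n ↦ X (n + 1)) hr ?_ hPr hP hX hk fun n ↦
    (add_le_add_left (hle (n + c + 1)) _).trans (hcg n)
  rw [← coe_moduleDim_self A] at hA
  exact_mod_cast hA

end Main

open IsLocalRing

theorem lemma3p1 {R' : Type*} {R : Type*} [CommRing R'] [IsRegularLocalRing R'] [CommRing R]
    [Algebra R' R] (hinj : Function.Injective (algebraMap R' R)) [Module.Finite R' R]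
    (hequi : IsEquidimensionalRing R) (p : Ideal R) [p.IsPrime]
    (hmult : localMultiplicity (Localization.AtPrime p) = (Module.finrank R' R : ℚ)) :
    (∀ q : Ideal R, q.IsPrime → q.under R' = p.under R' → q = p) ∧
      Function.Bijective
        (Ideal.ResidueField.map (p.under R') p (algebraMap R' R) rfl) := by
  have : IsDomain R' := IsRegularLocalRing.isDomain
  have : IsIntegrallyClosed R' := IsRegularLocalRing.isIntegrallyClosed
  have : IsNoetherianRing R := IsNoetherianRing.of_finite R' R
  have hreg := IsRegularLocalRing.localization_atPrime (p.under R')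
  obtain ⟨h, -, hh, -⟩ :=
    IsRegularLocalRing.exists_span_range_eq_maximalIdeal (Localization.AtPrime (p.under R'))
  have hdim (q : Ideal R) [q.IsPrime] (hq : q.under R' = p.under R') :
      (h : WithBot ℕ∞) ≤ ringKrullDim (Localization.AtPrime q) := by
    rw [hh, IsLocalization.AtPrime.ringKrullDim_eq_height (p.under R'),
      IsLocalization.AtPrime.ringKrullDim_eq_height q, ← hq]
    exact_mod_cast hequi.height_under_le_height hinj q
  let _ := Localization.AtPrime.algebraOfLiesOver (p.under R') p
  have : IsLocalHom (algebraMap (Localization.AtPrime (p.under R')) (Localization.AtPrime p)) :=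
    Localization.isLocalHom_localRingHom _ _ _ _
  refine ⟨fun q hq hqp ↦ ?_, ?_⟩
  · by_contra hne
    have : q.LiesOver (p.under R') := ⟨hqp.symm⟩
    let _ := Localization.AtPrime.algebraOfLiesOver (p.under R') q
    have : IsLocalHom (algebraMap (Localization.AtPrime (p.under R')) (Localization.AtPrime q)) :=
      Localization.isLocalHom_localRingHom _ _ _ _
    obtain ⟨k, hk, hX⟩ := exists_choose_le_length_quotient_maximalIdeal_pow h
      (Localization.AtPrime q) (hdim q hqp)
    -- A second prime q contributes the Hilbert function of R_q as the extra term.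
    refine false_of_length_add_le hinj (p.under R') hmult hh (hdim p rfl) hk
        (fun n ↦ Module.length (Localization.AtPrime q)
          (Localization.AtPrime q ⧸ maximalIdeal (Localization.AtPrime q) ^ n)) hX fun n ↦
      (add_le_add ?_ ?_).trans
        (length_quotient_add_le_length_tensorProduct (A := Localization.AtPrime p)
          (A₂ := Localization.AtPrime q) (p.under R') p q (Ne.symm hne) n)
    · exact length_le_length_of_isLocalHom _ _ _
    · exact length_le_length_of_isLocalHom _ _ _
  · have hone : Module.length (ResidueField (Localization.AtPrime (p.under R')))
        (ResidueField (Localization.AtPrime p)) = 1 := by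
      by_contra hne
      obtain ⟨k, hk, hX⟩ := exists_choose_le_length_quotient_maximalIdeal_pow h
        (Localization.AtPrime p) (hdim p rfl)
      -- The B-length is the length over R_p times the residue degree; if that degree is at least 2,
      -- a second copy of the Hilbert function of R_p is the extra term.
      refine false_of_length_add_le hinj (p.under R') hmult hh (hdim p rfl) hk
        (fun n ↦ Module.length (Localization.AtPrime p)
          (Localization.AtPrime p ⧸ maximalIdeal (Localization.AtPrime p) ^ n)) hX fun n ↦
        le_trans ?_ (length_quotient_le_length_tensorProduct (A := Localization.AtPrime p)
          (p.under R') p n)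
      rw [length_restrictScalars (Localization.AtPrime (p.under R')) (Localization.AtPrime p),
        ← mul_two]
      refine mul_le_mul_right ?_ _
      rw [← one_add_one_eq_two]
      exact Order.add_one_le_of_lt
        ((Order.one_le_iff_ne_zero.2 Module.length_pos.ne').lt_of_ne' hne)
    have hsimple := Module.length_eq_one_iff.1 hone
    refine ⟨RingHom.injective _, fun y ↦ ?_⟩
    obtain ⟨z, hz⟩ := IsSimpleModule.toSpanSingleton_surjective
      (ResidueField (Localization.AtPrime (p.under R')))
      (one_ne_zero (α := ResidueField (Localization.AtPrime p))) y
    refine ⟨z, ?_⟩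
    rw [LinearMap.toSpanSingleton_apply, ← Algebra.algebraMap_eq_smul_one] at hz
    exact hz
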